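/- For real $r>0$, say that a set $S\subset\mathbb{R}^2$ satisfies the $r$-rolling condition if for every $x\in\partial S$ there is an open ball $B$ of radius $r$ with $x\in\partial B$ and $B\cap S=\emptyset$. Let $0<\alpha<r$. For a finite set $\mathcal{X}\subset\mathbb{R}^2$, an $\alpha$-edge of $\mathcal{X}$ is a segment $[xy]$ with $x,y\in\mathcal{X}$ distinct such that there is an open ball $B$ of radius $\alpha$ with $x,y\in\partial B$ and $B\cap\mathcal{X}=\emptyset$; the $\alpha$-shape of $\mathcal{X}$ is the union $C_\alpha(\mathcal{X})$ of all its $\alpha$-edges. Proposition. Let $0<\alpha<r$ and $d\in\mathbb{R}$. There is a constant $A>0$, depending only on $(\alpha,r,d)$, such that the following holds for every compact set $S\subset\mathbb{R}^2$ of diameter $d$ such that both $S$ and $S^{\mathsf c}$ satisfy the $r$-rolling condition, and every $n$. Let $X_1,\dots,X_n$ be independent random points, each uniformly distributed on $S$, and let $C_\alpha=C_\alpha(\{X_1,\dots,X_n\})$. Then with probability at least $1-Ae^{-n/A}$: (i) every point of $C_\alpha$ has a unique nearest point in $\partial S$, and the resulting metric projection onto $\partial S$ is a bijection from $C_\alpha$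 onto $\partial S$; (ii) each connected component of $C_\alpha$ is a simple closed polygon (at least three vertices, all distinct, and two different edges meet at most in a common endpoint) whose edges are $\alpha$-edges, and the metric projection maps it onto one connected component of $\partial S$. -/

import Mathlib

/-- The Euclidean plane. -/
abbrev Plane : Type := EuclideanSpace ℝ (Fin 2)

/-- The `r`-rolling condition: every boundary point of `S` lies on the boundary of an open ball of
radius `r` that does not meet `S`. -/
def RollingCondition (r : ℝ) (S : Set Plane) : Prop :=
  ∀ x ∈ frontier S, ∃ c : Plane, x ∈ Metric.sphere c r ∧ Disjoint (Metric.ball c r) S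

/-- The pair of distinct points `x`, `y` of `T` forms an `α`-edge of `T`: both lie on the boundary
of some open ball of radius `α` that contains no point of `T`. -/
def IsAlphaEdge (α : ℝ) (T : Set Plane) (x y : Plane) : Prop :=
  x ∈ T ∧ y ∈ T ∧ x ≠ y ∧
    ∃ c : Plane, x ∈ Metric.sphere c α ∧ y ∈ Metric.sphere c α ∧ Disjoint (Metric.ball c α) T

/-- The `α`-shape of `T`, as a subset of the plane: the union of all `α`-edges (closed segments). -/
def alphaShape (α : ℝ) (T : Set Plane) : Set Plane :=
  {z | ∃ x y : Plane, IsAlphaEdge α T x y ∧ z ∈ segment ℝ x y}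

/-- The set of nearest points of `x` in `A`, that is, the argmin over `a ∈ A` of `dist x a`. -/
def nearestPoints (A : Set Plane) (x : Plane) : Set Plane :=
  {a | a ∈ A ∧ ∀ b ∈ A, dist x a ≤ dist x b}

/-- On `C` the metric projection onto `A` is well defined (single-valued) and it is given by `p`. -/
def IsMetricProjectionOn (A C : Set Plane) (p : Plane → Plane) : Prop :=
  ∀ x ∈ C, nearestPoints A x = {p x}

/-- A closed polygon is simple: it has at least three vertices, they are distinct, and two
different edges meet at most in a common endpoint. -/
def IsSimplePolygon {m : ℕ} (Q : Polygon Plane m) : Prop :=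
  3 ≤ m ∧ Function.Injective Q.vertices ∧
    ∀ i j : Fin m, i ≠ j →
      Q.edgeSet ℝ i ∩ Q.edgeSet ℝ j ⊆
        {Q i, Q (finRotate m i)} ∩ {Q j, Q (finRotate m j)}

/-! The two rolling conditions give each boundary point an open `r`-ball outside `S` and one inside
`S`, tangent to each other at that point. Hence the unit normal is `1/r`-Lipschitz along the
boundary, and a point of a normal line closer than `r` to its foot has that foot as its only nearest
boundary point.

Probability enters only through `IsRollingSample`: the sample hits every `ε`-ball contained in `S`,
and no circle of radius `α` carries three sample points. The rest is deterministic. An empty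
`α`-disc penetrates the inner tangent balls by less than `2 * ε`, so the disc of an edge nearly
coincides with an exterior tangent disc, and since `α < r` the ends of the edge lie close to the
point of tangency (`edge_near`). In the frame of that boundary point all edges are short chords at
the bottom of their circles.

Uniqueness: if the centres of two such empty discs are ordered along the tangent, so are their
contact points (`tcoord_le_of_lower`). Edges over one normal line therefore cross it at the same
point, and different edges share at most ends (`edges_cross`). Existence: an empty disc is pivoted
about a point until a sample point blocks it (`exists_roll`, `exists_lowest`), which yields an edge
over each boundary point and an edge on either side of each vertex. So each vertex has exactly one
successor and one predecessor, and the cycles of this permutation are the polygons. The projection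
is a continuous bijection from a compact set, hence a homeomorphism, and it matches components.

The density event has exponentially small failure probability by a union bound over a finite cover
whose size depends only on `ε` and `d`; three sample points on a circle of radius `α` have
probability zero. -/

open Metric Set Filter Topology MeasureTheory ProbabilityTheory

/-! ### Coordinates in the frame of a boundary point -/

/-- Tangential coordinate of `x` in the frame at `b` with unit normal `u`. -/
def tcoord (b u x : Plane) : ℝ := (x 0 - b 0) * u 1 - (x 1 - b 1) * u 0

/-- Normal coordinate of `x` in the frame at `b` with unit normal `u`. -/
def ncoord (b u x : Plane) : ℝ := (x 0 - b 0) * u 0 + (x 1 - b 1) * u 1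

/-- The clockwise rotation by a right angle. -/
def rot (u : Plane) : Plane := !₂[u 1, -u 0]

/-- The point with tangential coordinate `s` and normal coordinate `h`. -/
noncomputable def framePoint (b u : Plane) (s h : ℝ) : Plane := b + s • rot u + h • u

@[simp] lemma framePoint_zero (b u : Plane) (s h : ℝ) :
    framePoint b u s h 0 = b 0 + s * u 1 + h * u 0 := by
  simp [framePoint, rot]

@[simp] lemma framePoint_one (b u : Plane) (s h : ℝ) :
    framePoint b u s h 1 = b 1 - s * u 0 + h * u 1 := by
  simp [framePoint, rot]; ring

lemma plane_ext {x y : Plane} (h0 : x 0 = y 0) (h1 : x 1 = y 1) : x = y := by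
  ext i; fin_cases i <;> assumption

lemma add_smul_eq_framePoint (b u : Plane) (f : ℝ) : b + f • u = framePoint b u 0 f := by
  simp [framePoint]

lemma sub_smul_eq_framePoint (b u : Plane) (f : ℝ) : b - f • u = framePoint b u 0 (-f) := by
  simp [framePoint, sub_eq_add_neg]

lemma dist_sq_plane (x y : Plane) : dist x y ^ 2 = (x 0 - y 0) ^ 2 + (x 1 - y 1) ^ 2 := by
  rw [EuclideanSpace.dist_sq_eq, Fin.sum_univ_two, Real.dist_eq, Real.dist_eq, sq_abs, sq_abs]

/-- `u` is a unit vector. -/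
def IsUnit2 (u : Plane) : Prop := u 0 ^ 2 + u 1 ^ 2 = 1

section frame

variable {b u : Plane} (hu : IsUnit2 u)
include hu

lemma tcoord_framePoint (s h : ℝ) : tcoord b u (framePoint b u s h) = s := by
  simp only [tcoord, framePoint_zero, framePoint_one]
  unfold IsUnit2 at hu; linear_combination s * hu

lemma ncoord_framePoint (s h : ℝ) : ncoord b u (framePoint b u s h) = h := by
  simp only [ncoord, framePoint_zero, framePoint_one]
  unfold IsUnit2 at hu; linear_combination h * hu

lemma framePoint_coords (x : Plane) : framePoint b u (tcoord b u x) (ncoord b u x) = x := by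
  unfold IsUnit2 at hu
  apply plane_ext
  · simp only [framePoint_zero, tcoord, ncoord]; linear_combination (x 0 - b 0) * hu
  · simp only [framePoint_one, tcoord, ncoord]; linear_combination (x 1 - b 1) * hu

lemma frame_ext {x y : Plane} (h0 : tcoord b u x = tcoord b u y) (h1 : ncoord b u x = ncoord b u y) :
    x = y := by
  rw [← framePoint_coords (b := b) hu x, ← framePoint_coords (b := b) hu y, h0, h1]

lemma dist_sq_frame (b : Plane) (x y : Plane) :
    dist x y ^ 2 = (tcoord b u x - tcoord b u y) ^ 2 + (ncoord b u x - ncoord b u y) ^ 2 := by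
  unfold IsUnit2 at hu
  rw [dist_sq_plane]; simp only [tcoord, ncoord]
  linear_combination (-((x 0 - y 0) ^ 2 + (x 1 - y 1) ^ 2)) * hu

lemma dist_sq_framePoint (x : Plane) (s h : ℝ) :
    dist x (framePoint b u s h) ^ 2 = (tcoord b u x - s) ^ 2 + (ncoord b u x - h) ^ 2 := by
  rw [dist_sq_frame hu b, tcoord_framePoint hu, ncoord_framePoint hu]

lemma dist_sq_base (x : Plane) : dist x b ^ 2 = tcoord b u x ^ 2 + ncoord b u x ^ 2 := by
  rw [dist_sq_frame hu b]; simp [tcoord, ncoord]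

lemma abs_ncoord_le (x : Plane) : |ncoord b u x| ≤ dist x b := by
  apply abs_le_of_sq_le_sq _ dist_nonneg
  rw [dist_sq_base hu]; nlinarith [sq_nonneg (tcoord b u x)]

end frame

/-! ### Tangent balls, normals and nearest boundary points -/

lemma frontier_inter_nonempty_of_isPreconnected {X : Type*} [TopologicalSpace X] {s t : Set X}
    (ht : IsPreconnected t) (h1 : (t ∩ s).Nonempty) (h2 : (t ∩ sᶜ).Nonempty) :
    (t ∩ frontier s).Nonempty := by
  by_contra hne
  rw [not_nonempty_iff_eq_empty] at hne
  have key : t ⊆ interior s ∪ (closure s)ᶜ := by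
    intro x hx
    by_contra h
    simp only [mem_union, mem_compl_iff, not_or, not_not] at h
    exact (hne ▸ (⟨hx, h.2, h.1⟩ : x ∈ t ∩ frontier s) : x ∈ (∅ : Set X))
  obtain ⟨a, hat, has⟩ := h1
  obtain ⟨c, hct, hcs⟩ := h2
  obtain ⟨x, -, hx1, hx2⟩ := ht _ _ isOpen_interior isClosed_closure.isOpen_compl key
    ⟨a, hat, (key hat).resolve_right fun h => h (subset_closure has)⟩
    ⟨c, hct, (key hct).resolve_left fun h => hcs (interior_subset h)⟩
  exact hx2 (subset_closure (interior_subset hx1))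

/-- `u` is the outward unit normal of `S` at the boundary point `b`, with tangent open balls of
radius `r` on both sides. -/
structure IsNormal (S : Set Plane) (r : ℝ) (b u : Plane) : Prop where
  mem : b ∈ frontier S
  unit : IsUnit2 u
  outer : Disjoint (ball (b + r • u) r) S
  inner : ball (b - r • u) r ⊆ S

/-- The ball of the condition on `Sᶜ` lies in `S`, so it is disjoint from the one given for `S`. The
centres are then at least `2 * r` apart while both are at distance `r` from `b`, which forces `b` to
be their midpoint. -/
lemma exists_isNormal {S : Set Plane} {r : ℝ} (hr : 0 < r) (h1 : RollingCondition r S)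
    (h2 : RollingCondition r Sᶜ) {b : Plane} (hb : b ∈ frontier S) : ∃ u, IsNormal S r b u := by
  obtain ⟨c, hc, hcS⟩ := h1 b hb
  obtain ⟨c', hc', hcS'⟩ := h2 b (by rwa [frontier_compl])
  rw [disjoint_compl_right_iff_subset] at hcS'
  have hd := (disjoint_ball_ball_iff hr hr).1 (hcS.mono_right hcS')
  rw [mem_sphere] at hc hc'
  have e1 := dist_sq_plane b c
  have e2 := dist_sq_plane b c'
  have e3 := dist_sq_plane c c'
  rw [hc] at e1
  rw [hc'] at e2
  have e4 : (r + r) ^ 2 ≤ dist c c' ^ 2 := by gcongr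
  have z0 : (c 0 + c' 0 - 2 * b 0) ^ 2 + (c 1 + c' 1 - 2 * b 1) ^ 2 ≤ 0 := by nlinarith
  have z1 : c 0 + c' 0 - 2 * b 0 = 0 := by
    nlinarith [sq_nonneg (c 0 + c' 0 - 2 * b 0), sq_nonneg (c 1 + c' 1 - 2 * b 1)]
  have z2 : c 1 + c' 1 - 2 * b 1 = 0 := by
    nlinarith [sq_nonneg (c 0 + c' 0 - 2 * b 0), sq_nonneg (c 1 + c' 1 - 2 * b 1)]
  have k : r * r⁻¹ = 1 := mul_inv_cancel₀ hr.ne'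
  refine ⟨r⁻¹ • (c - b), hb, ?_, ?_, ?_⟩
  · simp only [IsUnit2, PiLp.smul_apply, PiLp.sub_apply, smul_eq_mul]
    have : (r⁻¹) ^ 2 * r ^ 2 = 1 := by rw [← mul_pow, mul_comm, k, one_pow]
    linear_combination this - (r⁻¹) ^ 2 * e1
  · rw [smul_smul, k, one_smul, add_sub_cancel]; exact hcS
  · rw [smul_smul, k, one_smul]
    have : b - (c - b) = c' := by
      apply plane_ext <;> simp only [PiLp.sub_apply] <;> linarith
    rw [this]; exact hcS'

namespace IsNormal

variable {S : Set Plane} {r : ℝ} {b u : Plane}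

lemma two_mul_ncoord_le (h : IsNormal S r b u) (hr : 0 < r) {x : Plane} (hx : x ∈ S) :
    2 * r * ncoord b u x ≤ dist x b ^ 2 := by
  have h1 : r ≤ dist x (b + r • u) := by
    by_contra hlt
    exact (Set.disjoint_left.1 h.outer) (mem_ball.2 (not_le.1 hlt)) hx
  have h2 : r ^ 2 ≤ dist x (b + r • u) ^ 2 := by gcongr
  rw [add_smul_eq_framePoint, dist_sq_framePoint h.unit] at h2
  rw [dist_sq_base h.unit]; nlinarith

lemma neg_two_mul_ncoord_le (h : IsNormal S r b u) (hr : 0 < r) {x : Plane}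
    (hx : x ∈ frontier S) : -(2 * r * ncoord b u x) ≤ dist x b ^ 2 := by
  have h1 : r ≤ dist x (b - r • u) := by
    by_contra hlt
    exact hx.2 (interior_maximal h.inner isOpen_ball (mem_ball.2 (not_le.1 hlt)))
  have h2 : r ^ 2 ≤ dist x (b - r • u) ^ 2 := by gcongr
  rw [sub_smul_eq_framePoint, dist_sq_framePoint h.unit] at h2
  rw [dist_sq_base h.unit]; nlinarith

/-- The outer ball at either point is disjoint from the inner ball at the other, so `(b - a) + r(u +
v)` and `(a - b) + r(u + v)` both have length at least `2r`. The parallelogram law and `|u + v|² = 4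
- |u - v|²` give the bound. -/
lemma dist_normal_le (h : IsNormal S r b u) (hr : 0 < r) {a v : Plane} (h' : IsNormal S r a v) :
    r * dist u v ≤ dist b a := by
  have k1 := (disjoint_ball_ball_iff hr hr).1 (h.outer.mono_right h'.inner)
  have k2 := (disjoint_ball_ball_iff hr hr).1 (h'.outer.mono_right h.inner)
  have k3 : (r + r) ^ 2 ≤ dist (b + r • u) (a - r • v) ^ 2 := by gcongr
  have k4 : (r + r) ^ 2 ≤ dist (a + r • v) (b - r • u) ^ 2 := by gcongr
  rw [dist_sq_plane] at k3 k4
  simp only [PiLp.add_apply, PiLp.sub_apply, PiLp.smul_apply, smul_eq_mul] at k3 k4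
  have hu := h.unit
  have hv := h'.unit
  unfold IsUnit2 at hu hv
  apply le_of_sq_le_sq _ dist_nonneg
  rw [mul_pow, dist_sq_plane, dist_sq_plane]
  nlinarith

end IsNormal

lemma ball_disjoint_of_nearest {S : Set Plane} {a z : Plane}
    (ha : a ∈ nearestPoints (frontier S) z) (hz : z ∉ S) : Disjoint (ball z (dist z a)) S := by
  by_contra hne
  obtain ⟨x, hx, hxS⟩ := Set.not_disjoint_iff.1 hne
  have hpos : 0 < dist z a := dist_nonneg.trans_lt (mem_ball.1 hx)
  obtain ⟨w, hw, hwf⟩ := frontier_inter_nonempty_of_isPreconnected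
    (convex_ball z (dist z a)).isPreconnected ⟨x, hx, hxS⟩ ⟨z, mem_ball_self hpos, hz⟩
  have := ha.2 w hwf
  rw [mem_ball, dist_comm] at hw
  linarith

lemma ball_subset_of_nearest {S : Set Plane} {a z : Plane}
    (ha : a ∈ nearestPoints (frontier S) z) (hz : z ∈ S) : ball z (dist z a) ⊆ S := by
  by_contra hne
  obtain ⟨x, hx, hxS⟩ := Set.not_subset.1 hne
  have hpos : 0 < dist z a := dist_nonneg.trans_lt (mem_ball.1 hx)
  obtain ⟨w, hw, hwf⟩ := frontier_inter_nonempty_of_isPreconnected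
    (convex_ball z (dist z a)).isPreconnected ⟨z, mem_ball_self hpos, hz⟩ ⟨x, hx, hxS⟩
  have := ha.2 w hwf
  rw [mem_ball, dist_comm] at hw
  linarith

/-- The ball about `z` reaching to `a` misses the inner tangent ball, so the centres are at least
`dist z a + r` apart. This is equality in the triangle inequality through `a`, hence `z` lies on the
outward normal ray. -/
lemma eq_add_of_nearest {S : Set Plane} {r : ℝ} (hr : 0 < r) {a u z : Plane}
    (h : IsNormal S r a u) (ha : a ∈ nearestPoints (frontier S) z) (hz : z ∉ S) :
    z = a + dist z a • u := by
  rcases (dist_nonneg (x := z) (y := a)).eq_or_lt with h0 | hpos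
  · rw [← h0]; simpa using dist_eq_zero.1 h0.symm
  have k := (disjoint_ball_ball_iff hpos hr).1 ((ball_disjoint_of_nearest ha hz).mono_right h.inner)
  have k2 : (dist z a + r) ^ 2 ≤ dist z (a - r • u) ^ 2 := by gcongr
  rw [sub_smul_eq_framePoint, dist_sq_framePoint h.unit] at k2
  have k3 := dist_sq_base h.unit (b := a) z
  have k4 := abs_ncoord_le h.unit (b := a) z
  have k5 := le_abs_self (ncoord a u z)
  have e1 : ncoord a u z = dist z a := by
    apply le_antisymm (k5.trans k4); nlinarith
  have e2 : tcoord a u z = 0 := by rw [e1] at k3; nlinarith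
  rw [add_smul_eq_framePoint]
  conv_lhs => rw [← framePoint_coords h.unit (b := a) z, e1, e2]

lemma eq_sub_of_nearest {S : Set Plane} {r : ℝ} (hr : 0 < r) {a u z : Plane}
    (h : IsNormal S r a u) (ha : a ∈ nearestPoints (frontier S) z) (hz : z ∈ S) :
    z = a - dist z a • u := by
  rcases (dist_nonneg (x := z) (y := a)).eq_or_lt with h0 | hpos
  · rw [← h0]; simpa using dist_eq_zero.1 h0.symm
  have k := (disjoint_ball_ball_iff hr hpos).1 (h.outer.mono_right (ball_subset_of_nearest ha hz))

  rw [dist_comm _ z] at k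
  have k2 : (r + dist z a) ^ 2 ≤ dist z (a + r • u) ^ 2 := by gcongr
  rw [add_smul_eq_framePoint, dist_sq_framePoint h.unit] at k2
  have k3 := dist_sq_base h.unit (b := a) z
  have k4 := abs_ncoord_le h.unit (b := a) z
  have k5 := neg_abs_le (ncoord a u z)
  have e1 : ncoord a u z = -dist z a := by
    apply le_antisymm _ (by linarith); nlinarith
  have e2 : tcoord a u z = 0 := by rw [e1] at k3; nlinarith
  rw [sub_smul_eq_framePoint]
  conv_lhs => rw [← framePoint_coords h.unit (b := a) z, e1, e2]

/-- A point has tangential coordinate zero in the frame at its nearest boundary point. -/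
lemma tcoord_eq_zero_of_nearest {S : Set Plane} {r : ℝ} (hr : 0 < r) {a u z : Plane}
    (h : IsNormal S r a u) (ha : a ∈ nearestPoints (frontier S) z) : tcoord a u z = 0 := by
  by_cases hz : z ∈ S
  · rw [eq_sub_of_nearest hr h ha hz, sub_smul_eq_framePoint, tcoord_framePoint h.unit]
  · rw [eq_add_of_nearest hr h ha hz, add_smul_eq_framePoint, tcoord_framePoint h.unit]

lemma nearestPoints_nonempty {A : Set Plane} (hA : IsCompact A) (hne : A.Nonempty) (z : Plane) :
    (nearestPoints A z).Nonempty := by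
  obtain ⟨a, ha, h⟩ := hA.exists_isMinOn hne (f := fun a => dist z a) (by fun_prop)
  exact ⟨a, ha, fun b hb => h hb⟩

/-- Points on the normal line at distance less than `r` have a unique nearest boundary point. -/
lemma nearestPoints_eq_singleton {S : Set Plane} (hS : IsClosed S) {r : ℝ} (hr : 0 < r)
    {b u z : Plane} (h : IsNormal S r b u) (ht : tcoord b u z = 0) (hn : |ncoord b u z| < r) :
    nearestPoints (frontier S) z = {b} := by
  have key : ∀ a ∈ frontier S, a ≠ b → dist z b ^ 2 < dist z a ^ 2 := by
    intro a ha hab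
    have hp : 0 < dist a b ^ 2 := by have := dist_pos.2 hab; positivity
    have k1 := h.two_mul_ncoord_le hr (hS.frontier_subset ha)
    have k2 := h.neg_two_mul_ncoord_le hr ha
    -- The point `a` lies in neither tangent `r`-ball at `b`, so `2r|ncoord a| ≤ |a - b|²`; as
    -- `|ncoord z| < r`, the cross term in `|z - a|²` cannot compensate for `|a - b|²`.
    have hh : 2 * (ncoord b u z * ncoord b u a) < dist a b ^ 2 := by
      have : 2 * r * |ncoord b u a| ≤ dist a b ^ 2 := by
        rcases abs_cases (ncoord b u a) with ⟨h1, _⟩ | ⟨h1, _⟩ <;> rw [h1] <;> linarith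
      have h3 := le_abs_self (ncoord b u z * ncoord b u a)
      rw [abs_mul] at h3
      rcases (abs_nonneg (ncoord b u a)).eq_or_lt with h4 | h4
      · rw [← h4] at h3; linarith
      · nlinarith
    rw [dist_sq_base h.unit] at hp hh ⊢
    rw [dist_sq_frame h.unit b z a, ht]
    nlinarith
  ext a
  simp only [nearestPoints, mem_ofPred_eq, mem_singleton_iff]
  constructor
  · rintro ⟨ha, hmin⟩
    by_contra hab
    have := key a ha hab
    have h2 := hmin b h.mem
    have : dist z a ^ 2 ≤ dist z b ^ 2 := by gcongr
    linarith
  · rintro rfl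
    refine ⟨h.mem, fun c hc => ?_⟩
    by_cases hca : c = a
    · rw [hca]
    · exact le_of_sq_le_sq (key c hc hca).le dist_nonneg

/-! ### Empty discs of edges are nearly tangent to the boundary -/

/-- An `α`-edge with a prescribed centre of the empty ball. -/
structure IsEdgeAt (α : ℝ) (T : Set Plane) (c x y : Plane) : Prop where
  left_mem : x ∈ T
  right_mem : y ∈ T
  ne : x ≠ y
  dist_left : dist x c = α
  dist_right : dist y c = α
  empty : Disjoint (ball c α) T

lemma IsEdgeAt.symm {α : ℝ} {T : Set Plane} {c x y : Plane} (h : IsEdgeAt α T c x y) :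
    IsEdgeAt α T c y x :=
  ⟨h.right_mem, h.left_mem, h.ne.symm, h.dist_right, h.dist_left, h.empty⟩

lemma IsEdgeAt.le_dist {α : ℝ} {T : Set Plane} {c x y z : Plane} (h : IsEdgeAt α T c x y)
    (hz : z ∈ T) : α ≤ dist z c := by
  by_contra hlt
  exact Set.disjoint_left.1 h.empty (mem_ball.2 (not_le.1 hlt)) hz

lemma isAlphaEdge_iff {α : ℝ} {T : Set Plane} {x y : Plane} :
    IsAlphaEdge α T x y ↔ ∃ c, IsEdgeAt α T c x y := by
  constructor
  · rintro ⟨hx, hy, hne, c, h1, h2, h3⟩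
    exact ⟨c, hx, hy, hne, h1, h2, h3⟩
  · rintro ⟨c, h⟩
    exact ⟨h.left_mem, h.right_mem, h.ne, c, h.dist_left, h.dist_right, h.empty⟩

/-- A finite sample of a set with tangent balls of radius `r` on both sides of its boundary: the
sample meets every ball of radius `ε` inside the set, and no three points of the sample lie on a
circle of radius `α`. -/
structure IsRollingSample (α r ε : ℝ) (S T : Set Plane) : Prop where
  alpha_pos : 0 < α
  alpha_lt : α < r
  eps_eq : ε = α * ((r - α) / r) ^ 2 / 10 ^ 8
  compact : IsCompact S
  normal : ∀ b ∈ frontier S, ∃ u, IsNormal S r b u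
  finite : T.Finite
  subset : T ⊆ S
  dense : ∀ z, ball z ε ⊆ S → ∃ t ∈ T, dist t z < ε
  generic : ∀ c, ∀ x ∈ T, ∀ y ∈ T, ∀ z ∈ T, dist x c = α → dist y c = α → dist z c = α →
    x ≠ y → z = x ∨ z = y

/-- The point `x` is in the ball of radius `α + κ` about `b + α • u` but outside the larger tangent
ball of radius `r`. Because `α < r`, these two curvatures confine it to a small neighbourhood of
`b`, of size about the square root of `κ`. -/
lemma dist_sq_mul_le {S : Set Plane} {α r κ : ℝ} (hα : 0 < α) (hαr : α < r) {b u c x : Plane}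
    (h : IsNormal S r b u) (hc : dist c (b + α • u) ≤ κ) (hκ : κ ≤ α) (hx : x ∈ S)
    (hxc : dist x c ≤ α) : dist x b ^ 2 * (r - α) ≤ 3 * r * α * κ := by
  have h0 : 0 ≤ κ := dist_nonneg.trans hc
  have h1 : dist x (b + α • u) ≤ α + κ := (dist_triangle _ c _).trans (add_le_add hxc hc)
  have h2 : dist x (b + α • u) ^ 2 ≤ (α + κ) ^ 2 := by gcongr
  rw [add_smul_eq_framePoint, dist_sq_framePoint h.unit] at h2
  have h3 := h.two_mul_ncoord_le (hα.trans hαr) hx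
  have h4 := dist_sq_base h.unit (b := b) x
  have h5 : dist x b ^ 2 - 2 * α * ncoord b u x ≤ 3 * α * κ := by nlinarith
  nlinarith

namespace IsRollingSample

variable {α r ε : ℝ} {S T : Set Plane} (H : IsRollingSample α r ε S T)
include H

lemma r_pos : 0 < r := H.alpha_pos.trans H.alpha_lt

lemma ratio_pos : 0 < (r - α) / r := div_pos (sub_pos.2 H.alpha_lt) H.r_pos

lemma ratio_lt_one : (r - α) / r < 1 := by
  rw [div_lt_one H.r_pos]; linarith [H.alpha_pos]

lemma eps_pos : 0 < ε := by
  rw [H.eps_eq]; have := H.ratio_pos; have := H.alpha_pos; positivity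

lemma eps_le_ratio : ε * 10 ^ 8 ≤ α * ((r - α) / r) := by
  rw [H.eps_eq]; have := H.ratio_pos; have := H.alpha_pos; have := H.ratio_lt_one
  have : ((r - α) / r) ^ 2 ≤ (r - α) / r := by nlinarith
  nlinarith

lemma eps_le : ε * 10 ^ 8 ≤ α := by
  have := H.eps_le_ratio; have := H.ratio_lt_one; have := H.alpha_pos; nlinarith

lemma center_far {b u c : Plane} (h : IsNormal S r b u) (hc : Disjoint (ball c α) T) :
    r + α - 2 * ε < dist c (b - r • u) := by
  by_contra hlt
  have h1 := H.eps_le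
  have h2 := H.eps_pos
  have h3 := H.alpha_lt
  obtain ⟨w, hw1, hw2⟩ := exists_dist_le_le (δ := α - ε) (ε := r - ε) (x := c) (z := b - r • u)
    (by linarith) (by linarith) (by linarith)
  obtain ⟨t, ht, htw⟩ := H.dense w fun p hp => h.inner <| by
    rw [mem_ball] at hp ⊢
    linarith [dist_triangle p w (b - r • u)]
  refine Set.disjoint_left.1 hc (mem_ball.2 ?_) ht
  linarith [dist_triangle t w c, dist_comm w c]

lemma frontier_compact : IsCompact (frontier S) :=
  H.compact.of_isClosed_subset isClosed_frontier H.compact.isClosed.frontier_subset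

lemma frontier_nonempty (hS : S.Nonempty) : (frontier S).Nonempty := by
  rw [nonempty_frontier_iff]
  exact ⟨hS, fun h => NormedSpace.unbounded_univ ℝ Plane (h ▸ H.compact.isBounded)⟩

/-- The centre lies outside `S`, hence on the normal ray of its nearest boundary point `a`. Its
height is at most `α` because the disc reaches `S`, and above `α - 2 * ε` by `center_far`. -/
lemma exists_normal_near {c x : Plane} (hc : Disjoint (ball c α) T) (hx : x ∈ S)
    (hxc : dist x c ≤ α) : ∃ a u, IsNormal S r a u ∧ dist c (a + α • u) ≤ 2 * ε := by
  have h1 := H.eps_le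
  have h2 := H.eps_pos
  have h3 := H.alpha_lt
  have hr := H.r_pos
  obtain ⟨a, ha⟩ := nearestPoints_nonempty H.frontier_compact (H.frontier_nonempty ⟨x, hx⟩) c
  obtain ⟨u, hu⟩ := H.normal a ha.1
  have hcS : c ∉ S := by
    intro hcS
    -- A centre in `S` at depth at least `ε` has a sample point within `ε`. A shallower one is
    -- within `ε` of `a`, and the `ε`-ball tangent at `a` from inside provides a sample point within
    -- `3 * ε < α`.
    rcases le_or_gt ε (dist c a) with hε | hε
    · obtain ⟨t, ht, htc⟩ := H.dense c
        ((ball_subset_ball hε).trans (ball_subset_of_nearest ha hcS))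
      exact Set.disjoint_left.1 hc (mem_ball.2 (by linarith)) ht
    · have hd : dist (a - ε • u) (a - r • u) = r - ε := by
        have : dist (a - ε • u) (a - r • u) ^ 2 = (r - ε) ^ 2 := by
          rw [sub_smul_eq_framePoint, sub_smul_eq_framePoint, dist_sq_framePoint hu.unit,
            tcoord_framePoint hu.unit, ncoord_framePoint hu.unit]; ring
        exact (sq_eq_sq₀ dist_nonneg (by linarith)).1 this
      have hd' : dist a (a - ε • u) = ε := by
        have : dist a (a - ε • u) ^ 2 = ε ^ 2 := by
          rw [dist_comm, dist_sq_base hu.unit, sub_smul_eq_framePoint,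
            tcoord_framePoint hu.unit, ncoord_framePoint hu.unit]; ring
        exact (sq_eq_sq₀ dist_nonneg (by linarith)).1 this
      obtain ⟨t, ht, htc⟩ := H.dense (a - ε • u) fun p hp => hu.inner <| by
        rw [mem_ball] at hp ⊢
        linarith [dist_triangle p (a - ε • u) (a - r • u)]
      refine Set.disjoint_left.1 hc (mem_ball.2 ?_) ht
      linarith [dist_triangle t (a - ε • u) c, dist_triangle c a (a - ε • u),
        dist_comm c (a - ε • u)]
  have hca := eq_add_of_nearest hr hu ha hcS
  have hle : dist c a ≤ α := by
    by_contra hlt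
    refine Set.disjoint_left.1 (ball_disjoint_of_nearest ha hcS) (mem_ball.2 ?_) hx
    linarith
  have hfar := H.center_far hu hc
  have hd1 : dist c (a - r • u) ≤ dist c a + r := by
    refine (dist_triangle c a _).trans (add_le_add le_rfl ?_)
    apply le_of_sq_le_sq _ hr.le
    rw [dist_comm, dist_sq_base hu.unit, sub_smul_eq_framePoint,
            tcoord_framePoint hu.unit, ncoord_framePoint hu.unit]; linarith
  refine ⟨a, u, hu, ?_⟩
  apply abs_le_of_sq_le_sq' _ (by linarith) |>.2
  have e : c = framePoint a u 0 (dist c a) := by rw [← add_smul_eq_framePoint]; exact hca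
  rw [add_smul_eq_framePoint, dist_sq_framePoint hu.unit]
  rw [e, tcoord_framePoint hu.unit, ncoord_framePoint hu.unit]
  nlinarith

/-- The ends are first located near the foot `a` of the disc's centre. The foot `b` of `z` is at
least as close to `z` as `a`, so `a` and `b` are close, and the Lipschitz normal transfers the
estimates from the frame at `a` to the frame at `b`. -/
lemma edge_near {c x y z b u : Plane} (hE : IsEdgeAt α T c x y) (hz : z ∈ segment ℝ x y)
    (hb : b ∈ nearestPoints (frontier S) z) (hu : IsNormal S r b u) :
    dist x b ≤ α / 10 ∧ dist y b ≤ α / 10 ∧ dist c (b + α • u) ≤ α / 10 := by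
  have h1 := H.eps_le
  have h2 := H.eps_pos
  have h3 := H.alpha_lt
  have h4 := H.eps_le_ratio
  have h5 := H.eps_eq
  have hα := H.alpha_pos
  have hr := H.r_pos
  have h6 := H.ratio_pos
  obtain ⟨a, v, hv, hcv⟩ := H.exists_normal_near hE.empty (H.subset hE.left_mem) hE.dist_left.le
  have key : ∀ p ∈ S, dist p c ≤ α → dist p a ≤ α / 50 := by
    intro p hp hpc
    have := dist_sq_mul_le hα h3 hv hcv (by linarith) hp hpc
    apply le_of_sq_le_sq _ (by positivity)
    have e : r - α = r * ((r - α) / r) := by field_simp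
    rw [e] at this
    set l := (r - α) / r
    have h7 : dist p a ^ 2 * l ≤ 6 * α * ε := by
      have : r * (dist p a ^ 2 * l) ≤ r * (6 * α * ε) := by linarith
      exact le_of_mul_le_mul_left this hr
    have h8 : 6 * α * ε ≤ (α / 50) ^ 2 * l := by nlinarith
    exact le_of_mul_le_mul_right (h7.trans h8) h6
  have hx := key x (H.subset hE.left_mem) hE.dist_left.le
  have hy := key y (H.subset hE.right_mem) hE.dist_right.le
  have hza : dist z a ≤ α / 50 :=
    (convex_closedBall a (α / 50)).segment_subset (mem_closedBall.2 hx) (mem_closedBall.2 hy) hz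
  have hzb : dist z b ≤ α / 50 := (hb.2 a hv.mem).trans hza
  have hab : dist a b ≤ α / 25 := by linarith [dist_triangle a z b, dist_comm a z]
  refine ⟨by linarith [dist_triangle x a b], by linarith [dist_triangle y a b], ?_⟩
  have hn := hv.dist_normal_le hr hu
  have hn2 : α * dist v u ≤ α / 25 := by
    have := dist_nonneg (x := v) (y := u)
    nlinarith
  have e1 : dist (a + α • v) (b + α • u) ≤ dist a b + α * dist v u := by
    refine (dist_add_add_le _ _ _ _).trans ?_
    rw [dist_smul₀, Real.norm_eq_abs, abs_of_pos hα]
  linarith [dist_triangle c (a + α • v) (b + α • u)]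

end IsRollingSample

/-! ### Order of chords in a common frame -/

/-- Four points with the same sums, the outer two on a circle and the inner two not inside it. -/
lemma no_chord_above {α A B A' B' a b a' b' : ℝ} (ha' : 0 < a')
    (hb' : 0 < b') (h1 : A ^ 2 + a ^ 2 = α ^ 2) (h2 : B ^ 2 + b ^ 2 = α ^ 2)
    (h3 : α ^ 2 ≤ A' ^ 2 + a' ^ 2) (h4 : α ^ 2 ≤ B' ^ 2 + b' ^ 2) (hs : A + B = A' + B')
    (hh : a + b = a' + b') (hA : A' < A) (hB : B < A') : False := by
  have hAB : 0 < A - B := by linarith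
  obtain ⟨t, ht⟩ : ∃ t, t * (A - B) = A' - B := ⟨(A' - B) / (A - B), by field_simp⟩
  have ht0 : 0 < t := by nlinarith
  have ht1 : t < 1 := by nlinarith
  have hP : 0 < t * (1 - t) * (A - B) ^ 2 := by have := sub_pos.2 ht1; positivity
  have hQ : 0 ≤ t * (1 - t) * (a - b) ^ 2 := by have := sub_pos.2 ht1; positivity
  have e1 : A' = t * A + (1 - t) * B := by linarith
  have e2 : B' = (1 - t) * A + t * B := by linarith
  -- The corresponding point of the chord is strictly inside the circle by `hP`. The point `(A',
  -- a')` has the same abscissa and is not inside, so it is strictly farther along the positive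
  -- axis; the same holds for `B'`, and the sum of heights then contradicts `hh`.
  have k1 : t * a + (1 - t) * b < a' := by
    apply lt_of_pow_lt_pow_left₀ 2 ha'.le
    rw [e1] at h3
    nlinarith
  have k2 : (1 - t) * a + t * b < b' := by
    apply lt_of_pow_lt_pow_left₀ 2 hb'.le
    rw [e2] at h4
    nlinarith
  linarith

section lower

variable {α : ℝ} {b u c c' P P' : Plane}

/-- The vectors from `P` to `c` and from `P'` to `c'` have the same sum as those with the centres
exchanged. If the contact points were in the wrong order, the exchanged pair would lie between the
original pair, which `no_chord_above` excludes. -/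
lemma tcoord_le_of_lower (hu : IsUnit2 u) (hα : 0 < α) (h1 : dist P c = α) (h2 : dist P' c' = α)
    (h3 : α ≤ dist P c') (h4 : α ≤ dist P' c) (l2 : ncoord b u P < ncoord b u c') (l3 : ncoord b u P' < ncoord b u c) (h : tcoord b u c < tcoord b u c') :
    tcoord b u P ≤ tcoord b u P' ∧ (tcoord b u P = tcoord b u P' → P = P') := by
  have e1 := dist_sq_frame hu b P c
  have e2 := dist_sq_frame hu b P' c'
  have e3 := dist_sq_frame hu b P c'
  have e4 := dist_sq_frame hu b P' c
  have e3' : α ^ 2 ≤ dist P c' ^ 2 := by gcongr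
  have e4' : α ^ 2 ≤ dist P' c ^ 2 := by gcongr
  rw [h1] at e1
  rw [h2] at e2
  rw [e3] at e3'
  rw [e4] at e4'
  constructor
  · by_contra hlt
    push Not at hlt
    exact no_chord_above (sub_pos.2 l2) (sub_pos.2 l3) (α := α)
      (a := ncoord b u c - ncoord b u P) (b := ncoord b u c' - ncoord b u P')
      (A := tcoord b u P - tcoord b u c) (B := tcoord b u P' - tcoord b u c')
      (A' := tcoord b u P - tcoord b u c') (B' := tcoord b u P' - tcoord b u c)
      (by linarith) (by linarith) (by linarith) (by linarith) (by ring) (by ring)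
      (by linarith) (by linarith)
  · intro heq
    apply frame_ext (b := b) hu heq
    rw [heq] at e1 e3'
    have k1 : ncoord b u c' - ncoord b u P' ≤ ncoord b u c' - ncoord b u P :=
      le_of_sq_le_sq (by linarith) (by linarith)
    have k2 : ncoord b u c - ncoord b u P ≤ ncoord b u c - ncoord b u P' :=
      le_of_sq_le_sq (by linarith) (by linarith)
    linarith

lemma center_eq_of_lower (hu : IsUnit2 u) (hα : 0 < α) (h1 : dist P c = α) (h2 : dist P' c' = α)
    (h3 : α ≤ dist P c') (h4 : α ≤ dist P' c) (l2 : ncoord b u P < ncoord b u c') (l3 : ncoord b u P' < ncoord b u c) (h : tcoord b u c = tcoord b u c') : c = c' := by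
  have e1 := dist_sq_frame hu b P c
  have e2 := dist_sq_frame hu b P' c'
  have e3 := dist_sq_frame hu b P c'
  have e4 := dist_sq_frame hu b P' c
  have e3' : α ^ 2 ≤ dist P c' ^ 2 := by gcongr
  have e4' : α ^ 2 ≤ dist P' c ^ 2 := by gcongr
  rw [h1] at e1
  rw [h2] at e2
  rw [e3] at e3'
  rw [e4] at e4'
  rw [h] at e1 e4'
  apply frame_ext (b := b) hu h
  have k1 : ncoord b u c - ncoord b u P ≤ ncoord b u c' - ncoord b u P :=
    le_of_sq_le_sq (by linarith) (by linarith)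
  have k2 : ncoord b u c' - ncoord b u P' ≤ ncoord b u c - ncoord b u P' :=
    le_of_sq_le_sq (by linarith) (by linarith)
  linarith

end lower

/-- A chord of a circle of radius `α` which in the frame at `b` lies at the bottom of the circle,
close to the origin. -/
structure IsNearChord (α : ℝ) (b u c x y : Plane) : Prop where
  pos : 0 < α
  unit : IsUnit2 u
  ne : x ≠ y
  dist_left : dist x c = α
  dist_right : dist y c = α
  near_left : dist x b ≤ α / 10
  near_right : dist y b ≤ α / 10
  near_center : dist c (b + α • u) ≤ α / 10

/-- Twice the signed area of the triangle `c x y`. -/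
def turn (c x y : Plane) : ℝ := (x 0 - c 0) * (y 1 - c 1) - (x 1 - c 1) * (y 0 - c 0)

lemma turn_swap (c x y : Plane) : turn c y x = -turn c x y := by unfold turn; ring

lemma turn_frame {u : Plane} (hu : IsUnit2 u) (b c x y : Plane) :
    turn c x y = (tcoord b u x - tcoord b u c) * (ncoord b u y - ncoord b u c) -
      (ncoord b u x - ncoord b u c) * (tcoord b u y - tcoord b u c) := by
  unfold turn tcoord ncoord IsUnit2 at *
  linear_combination (-((x 0 - c 0) * (y 1 - c 1) - (x 1 - c 1) * (y 0 - c 0))) * hu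

namespace IsNearChord

variable {α : ℝ} {b u c x y c' x' y' : Plane}

lemma symm (h : IsNearChord α b u c x y) : IsNearChord α b u c y x :=
  ⟨h.pos, h.unit, h.ne.symm, h.dist_right, h.dist_left, h.near_right, h.near_left, h.near_center⟩

lemma lt_ncoord_center (h : IsNearChord α b u c x y) : α / 2 < ncoord b u c := by
  have h1 : dist c (b + α • u) ^ 2 ≤ (α / 10) ^ 2 := by
    have := h.near_center; gcongr
  rw [add_smul_eq_framePoint, dist_sq_framePoint h.unit] at h1
  have := h.pos
  nlinarith [sq_nonneg (tcoord b u c)]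

lemma ncoord_left (h : IsNearChord α b u c x y) : ncoord b u x ≤ α / 10 :=
  (le_abs_self _).trans ((abs_ncoord_le h.unit x).trans h.near_left)

lemma ncoord_right (h : IsNearChord α b u c x y) : ncoord b u y ≤ α / 10 := h.symm.ncoord_left

lemma tcoord_ne (h : IsNearChord α b u c x y) : tcoord b u x ≠ tcoord b u y := by
  intro heq
  apply h.ne
  have e1 := dist_sq_frame h.unit b x c
  have e2 := dist_sq_frame h.unit b y c
  rw [h.dist_left] at e1
  rw [h.dist_right, ← heq] at e2
  apply frame_ext (b := b) h.unit heq
  have := h.ncoord_left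
  have := h.ncoord_right
  have := h.lt_ncoord_center
  have := h.pos
  have : (ncoord b u c - ncoord b u x) ^ 2 = (ncoord b u c - ncoord b u y) ^ 2 := by linarith
  rw [sq_eq_sq₀ (by linarith) (by linarith)] at this
  linarith

/-- The sign of `turn` does not involve the frame, so this gives edges an orientation that is
consistent across all nearby boundary frames. -/
lemma tcoord_lt_iff (h : IsNearChord α b u c x y) :
    0 < turn c x y ↔ tcoord b u x < tcoord b u y := by
  have e1 := dist_sq_frame h.unit b x c
  have e2 := dist_sq_frame h.unit b y c
  rw [h.dist_left] at e1
  rw [h.dist_right] at e2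
  rw [turn_frame h.unit b]
  have h1 := h.ncoord_left
  have h2 := h.ncoord_right
  have h3 := h.lt_ncoord_center
  have h4 := h.pos
  set X := tcoord b u x - tcoord b u c
  set Y := tcoord b u y - tcoord b u c
  set A := ncoord b u x - ncoord b u c
  set B := ncoord b u y - ncoord b u c
  have hY : tcoord b u y - tcoord b u x = Y - X := by simp only [X, Y]; ring
  have hAB : 0 < -(A + B) := by simp only [A, B]; linarith
  have hA : A < 0 := by simp only [A]; linarith
  have hB : B < 0 := by simp only [B]; linarith
  -- Both ends being on the circle, `2(α² + XY) = (X + Y)² + A² + B²`.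
  have hpos : 0 < α ^ 2 + X * Y + A * B := by nlinarith [mul_pos_of_neg_of_neg hA hB, sq_nonneg (X + Y), sq_pos_of_neg hA, sq_pos_of_neg hB]
  have key : (X * B - A * Y) * -(A + B) = (Y - X) * (α ^ 2 + X * Y + A * B) := by
    linear_combination -Y * e1 + X * e2
  constructor
  · intro h
    have : 0 < (Y - X) * (α ^ 2 + X * Y + A * B) := by rw [← key]; exact mul_pos h hAB
    have := (pos_iff_pos_of_mul_pos this).2 hpos
    linarith
  · intro h
    have : 0 < (X * B - A * Y) * -(A + B) := by rw [key]; exact mul_pos (by linarith) hpos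
    exact (pos_iff_pos_of_mul_pos this).2 hAB

/-- Of two chords with mutually empty discs, the one whose centre is further left lies to the left
of the other one, and they can only touch at a common end. -/
lemma left_of_lt (h : IsNearChord α b u c x y) (h' : IsNearChord α b u c' x' y')
    (hx : α ≤ dist x c') (hx' : α ≤ dist x' c) (hlt : tcoord b u c < tcoord b u c') :
    tcoord b u x ≤ tcoord b u x' ∧ (tcoord b u x = tcoord b u x' → x = x') := by
  have := h.ncoord_left
  have := h'.ncoord_left
  have := h.lt_ncoord_center
  have := h'.lt_ncoord_center
  have := h.pos
  exact tcoord_le_of_lower h.unit h.pos h.dist_left h'.dist_left hx hx' (by linarith)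
    (by linarith) hlt

lemma center_eq (h : IsNearChord α b u c x y) (h' : IsNearChord α b u c' x' y')
    (hx : α ≤ dist x c') (hx' : α ≤ dist x' c) (heq : tcoord b u c = tcoord b u c') : c = c' := by
  have := h.ncoord_left
  have := h'.ncoord_left
  have := h.lt_ncoord_center
  have := h'.lt_ncoord_center
  have := h.pos
  exact center_eq_of_lower h.unit h.pos h.dist_left h'.dist_left hx hx' (by linarith)
    (by linarith) heq

end IsNearChord

lemma tcoord_combo (b u x y : Plane) {s t : ℝ} (hst : s + t = 1) :
    tcoord b u (s • x + t • y) = s * tcoord b u x + t * tcoord b u y := by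
  simp only [tcoord, PiLp.add_apply, PiLp.smul_apply, smul_eq_mul]
  linear_combination (b 1 * u 0 - b 0 * u 1) * (-1) * hst

/-- A point of a non-vertical segment whose tangential coordinate bounds those of both ends is an
end. -/
lemma eq_end_of_le {b u x y z : Plane} (hz : z ∈ segment ℝ x y)
    (hne : tcoord b u x ≠ tcoord b u y) (h1 : tcoord b u x ≤ tcoord b u z)
    (h2 : tcoord b u y ≤ tcoord b u z) : z = x ∨ z = y := by
  obtain ⟨s, t, hs, ht, hst, rfl⟩ := hz
  rw [tcoord_combo b u x y hst] at h1 h2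
  have hs' : s = 1 - t := by linarith
  rcases hs.eq_or_lt with h0 | hs0
  · right; rw [← h0] at hst ⊢; rw [zero_add] at hst; simp [hst]
  rcases ht.eq_or_lt with h0 | ht0
  · left; rw [← h0] at hst ⊢; rw [add_zero] at hst; simp [hst]
  exfalso
  apply hne
  have k1 : t * (tcoord b u x - tcoord b u y) ≤ 0 := by rw [hs'] at h1; linarith
  have k2 : s * (tcoord b u y - tcoord b u x) ≤ 0 := by
    rw [show t = 1 - s by linarith] at h2; linarith
  nlinarith

lemma eq_end_of_ge {b u x y z : Plane} (hz : z ∈ segment ℝ x y)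
    (hne : tcoord b u x ≠ tcoord b u y) (h1 : tcoord b u z ≤ tcoord b u x)
    (h2 : tcoord b u z ≤ tcoord b u y) : z = x ∨ z = y := by
  obtain ⟨s, t, hs, ht, hst, rfl⟩ := hz
  rw [tcoord_combo b u x y hst] at h1 h2
  have hs' : s = 1 - t := by linarith
  rcases hs.eq_or_lt with h0 | hs0
  · right; rw [← h0] at hst ⊢; rw [zero_add] at hst; simp [hst]
  rcases ht.eq_or_lt with h0 | ht0
  · left; rw [← h0] at hst ⊢; rw [add_zero] at hst; simp [hst]
  exfalso
  apply hne
  have k1 : t * (tcoord b u y - tcoord b u x) ≤ 0 := by rw [hs'] at h1; linarith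
  have k2 : s * (tcoord b u x - tcoord b u y) ≤ 0 := by
    rw [show t = 1 - s by linarith] at h2; linarith
  nlinarith

lemma eq_of_mem_segment_of_tcoord_eq {b u x y z z' : Plane} (hz : z ∈ segment ℝ x y)
    (hz' : z' ∈ segment ℝ x y) (hne : tcoord b u x ≠ tcoord b u y)
    (h : tcoord b u z = tcoord b u z') : z = z' := by
  obtain ⟨s, t, -, -, hst, rfl⟩ := hz
  obtain ⟨s', t', -, -, hst', rfl⟩ := hz'
  rw [tcoord_combo b u x y hst, tcoord_combo b u x y hst'] at h
  have e1 : s = 1 - t := by linarith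
  have e2 : s' = 1 - t' := by linarith
  have : (t - t') * (tcoord b u y - tcoord b u x) = 0 := by rw [e1, e2] at h; linarith
  have : t = t' := by
    rcases mul_eq_zero.1 this with h | h
    · linarith
    · exact absurd (by linarith) hne
  rw [e1, e2, this]

lemma tcoord_mem_segment_or {b u x y z : Plane} (hz : z ∈ segment ℝ x y) :
    (tcoord b u z ≤ tcoord b u x ∨ tcoord b u z ≤ tcoord b u y) ∧
    (tcoord b u x ≤ tcoord b u z ∨ tcoord b u y ≤ tcoord b u z) := by
  obtain ⟨s, t, hs, ht, hst, rfl⟩ := hz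
  rw [tcoord_combo b u x y hst]
  have hs' : s = 1 - t := by linarith
  subst hs'
  constructor
  · by_contra! h
    rcases le_total (tcoord b u x) (tcoord b u y) with h' | h'
    · nlinarith [mul_nonneg hs (sub_nonneg.2 h')]
    · nlinarith [mul_nonneg ht (sub_nonneg.2 h')]
  · by_contra! h
    rcases le_total (tcoord b u x) (tcoord b u y) with h' | h'
    · nlinarith [mul_nonneg ht (sub_nonneg.2 h')]
    · nlinarith [mul_nonneg hs (sub_nonneg.2 h')]

/-! ### Crossings of edges and uniqueness of neighbours -/

namespace IsRollingSample

variable {α r ε : ℝ} {S T : Set Plane} (H : IsRollingSample α r ε S T)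
include H

lemma nearChord {c x y z b u : Plane} (hE : IsEdgeAt α T c x y) (hz : z ∈ segment ℝ x y)
    (hb : b ∈ nearestPoints (frontier S) z) (hu : IsNormal S r b u) :
    IsNearChord α b u c x y := by
  obtain ⟨h1, h2, h3⟩ := H.edge_near hE hz hb hu
  exact ⟨H.alpha_pos, hu.unit, hE.ne, hE.dist_left, hE.dist_right, h1, h2, h3⟩

/-- Edges with the same circle have the same ends. -/
lemma ends_eq {c x y x' y' : Plane} (hE : IsEdgeAt α T c x y) (hE' : IsEdgeAt α T c x' y') :
    (x' = x ∧ y' = y) ∨ (x' = y ∧ y' = x) := by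
  have h1 := H.generic c x hE.left_mem y hE.right_mem x' hE'.left_mem hE.dist_left hE.dist_right
    hE'.dist_left hE.ne
  have h2 := H.generic c x hE.left_mem y hE.right_mem y' hE'.right_mem hE.dist_left hE.dist_right
    hE'.dist_right hE.ne
  have h3 := hE'.ne
  grind

-- By `left_of_lt` both ends of the first edge lie weakly left of both ends of the second. A common
-- abscissa must then be extreme for both segments, hence attained at an end of each, and ends with
-- equal abscissa coincide.
omit H in
lemma edges_cross_of_lt {c x y c' x' y' b u z z' : Plane} (hE : IsEdgeAt α T c x y)
    (hE' : IsEdgeAt α T c' x' y') (h : IsNearChord α b u c x y)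
    (h' : IsNearChord α b u c' x' y') (hz : z ∈ segment ℝ x y) (hz' : z' ∈ segment ℝ x' y')
    (hzz : tcoord b u z = tcoord b u z') (hlt : tcoord b u c < tcoord b u c') :
    z = z' ∧ (z = x ∨ z = y) ∧ (z = x' ∨ z = y') := by
  have k1 := h.left_of_lt h' (hE'.le_dist hE.left_mem) (hE.le_dist hE'.left_mem) hlt
  have k2 := h.left_of_lt h'.symm (hE'.le_dist hE.left_mem) (hE.le_dist hE'.right_mem) hlt
  have k3 := h.symm.left_of_lt h' (hE'.le_dist hE.right_mem) (hE.le_dist hE'.left_mem) hlt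
  have k4 := h.symm.left_of_lt h'.symm (hE'.le_dist hE.right_mem) (hE.le_dist hE'.right_mem) hlt
  have m1 := tcoord_mem_segment_or (b := b) (u := u) hz
  have m2 := tcoord_mem_segment_or (b := b) (u := u) hz'
  have a1 : z = x ∨ z = y := by
    apply eq_end_of_le hz h.tcoord_ne
    · rcases m2.2 with m | m <;> linarith [k1.1, k2.1]
    · rcases m2.2 with m | m <;> linarith [k3.1, k4.1]
  have a2 : z' = x' ∨ z' = y' := by
    apply eq_end_of_ge hz' h'.tcoord_ne
    · rcases m1.1 with m | m <;> linarith [k1.1, k3.1]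
    · rcases m1.1 with m | m <;> linarith [k2.1, k4.1]
  have a3 : z = z' := by
    rcases a1 with rfl | rfl <;> rcases a2 with rfl | rfl
    · exact k1.2 hzz
    · exact k2.2 hzz
    · exact k3.2 hzz
    · exact k4.2 hzz
  exact ⟨a3, a1, a3 ▸ a2⟩

/-- Two edges crossing the same normal line do so at the same point, and unless they are equal
it is a common end. -/
lemma edges_cross {c x y c' x' y' b u z z' : Plane} (hE : IsEdgeAt α T c x y)
    (hE' : IsEdgeAt α T c' x' y') (h : IsNearChord α b u c x y)
    (h' : IsNearChord α b u c' x' y') (hz : z ∈ segment ℝ x y) (hz' : z' ∈ segment ℝ x' y')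
    (hzz : tcoord b u z = tcoord b u z') :
    z = z' ∧ (((x' = x ∧ y' = y) ∨ (x' = y ∧ y' = x)) ∨
      ((z = x ∨ z = y) ∧ (z = x' ∨ z = y'))) := by
  rcases lt_trichotomy (tcoord b u c) (tcoord b u c') with hlt | heq | hlt
  · obtain ⟨k1, k2⟩ := edges_cross_of_lt hE hE' h h' hz hz' hzz hlt
    exact ⟨k1, Or.inr k2⟩
  · have hc := h.center_eq h' (hE'.le_dist hE.left_mem) (hE.le_dist hE'.left_mem) heq
    subst hc
    have hends := H.ends_eq hE hE'
    refine ⟨?_, Or.inl hends⟩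
    refine eq_of_mem_segment_of_tcoord_eq hz ?_ h.tcoord_ne hzz
    rcases hends with ⟨rfl, rfl⟩ | ⟨rfl, rfl⟩
    · exact hz'
    · rwa [segment_symm]
  · obtain ⟨rfl, k2, k3⟩ := edges_cross_of_lt hE' hE h' h hz' hz hzz.symm hlt
    exact ⟨rfl, Or.inr ⟨k3, k2⟩⟩

/-- An end of an edge has at most one edge leaving it counterclockwise as seen from the centre. -/
lemma right_unique {c x y c' y' : Plane} (hE : IsEdgeAt α T c x y) (hE' : IsEdgeAt α T c' x y')
    (ht : 0 < turn c x y) (ht' : 0 < turn c' x y') : y = y' := by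
  obtain ⟨b, hb⟩ := nearestPoints_nonempty H.frontier_compact
    (H.frontier_nonempty ⟨x, H.subset hE.left_mem⟩) x
  obtain ⟨u, hu⟩ := H.normal b hb.1
  have h := H.nearChord hE (left_mem_segment ℝ x y) hb hu
  have h' := H.nearChord hE' (left_mem_segment ℝ x y') hb hu
  rw [h.tcoord_lt_iff] at ht
  rw [h'.tcoord_lt_iff] at ht'
  rcases lt_trichotomy (tcoord b u c) (tcoord b u c') with hlt | heq | hlt
  · have := (h.symm.left_of_lt h' (hE'.le_dist hE.right_mem) (hE.le_dist hE'.left_mem) hlt).1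
    linarith
  · have hc := h.center_eq h' (hE'.le_dist hE.left_mem) (hE.le_dist hE'.left_mem) heq
    subst hc
    have := H.ends_eq hE hE'
    have := hE.ne
    have := hE'.ne
    grind
  · have := (h'.symm.left_of_lt h (hE.le_dist hE'.right_mem) (hE'.le_dist hE.left_mem) hlt).1
    linarith

lemma left_unique {c x y c' y' : Plane} (hE : IsEdgeAt α T c x y) (hE' : IsEdgeAt α T c' x y')
    (ht : turn c x y < 0) (ht' : turn c' x y' < 0) : y = y' := by
  obtain ⟨b, hb⟩ := nearestPoints_nonempty H.frontier_compact
    (H.frontier_nonempty ⟨x, H.subset hE.left_mem⟩) x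
  obtain ⟨u, hu⟩ := H.normal b hb.1
  have h := H.nearChord hE (left_mem_segment ℝ x y) hb hu
  have h' := H.nearChord hE' (left_mem_segment ℝ x y') hb hu
  have ht2 : 0 < turn c y x := by rw [turn_swap]; linarith
  have ht2' : 0 < turn c' y' x := by rw [turn_swap]; linarith
  rw [h.symm.tcoord_lt_iff] at ht2
  rw [h'.symm.tcoord_lt_iff] at ht2'
  rcases lt_trichotomy (tcoord b u c) (tcoord b u c') with hlt | heq | hlt
  · have := (h.left_of_lt h'.symm (hE'.le_dist hE.left_mem) (hE.le_dist hE'.right_mem) hlt).1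
    linarith
  · have hc := h.center_eq h' (hE'.le_dist hE.left_mem) (hE.le_dist hE'.left_mem) heq
    subst hc
    have := H.ends_eq hE hE'
    have := hE.ne
    have := hE'.ne
    grind
  · have := (h'.left_of_lt h.symm (hE.le_dist hE'.left_mem) (hE'.le_dist hE.right_mem) hlt).1
    linarith

lemma turn_ne_zero {c x y : Plane} (hE : IsEdgeAt α T c x y) : turn c x y ≠ 0 := by
  obtain ⟨b, hb⟩ := nearestPoints_nonempty H.frontier_compact
    (H.frontier_nonempty ⟨x, H.subset hE.left_mem⟩) x
  obtain ⟨u, hu⟩ := H.normal b hb.1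
  have h := H.nearChord hE (left_mem_segment ℝ x y) hb hu
  rcases lt_or_gt_of_ne h.tcoord_ne with hlt | hlt
  · exact (h.tcoord_lt_iff.2 hlt).ne'
  · have := h.symm.tcoord_lt_iff.2 hlt
    rw [turn_swap] at this
    intro h0
    linarith

end IsRollingSample

/-! ### Rolling an empty disc about a pivot on the normal line -/

/-- The centre of the circle of radius `α` through the point at height `f` on the normal line,
rotated by the angle `θ` about that point. -/
noncomputable def rollCenter (α : ℝ) (b u : Plane) (f θ : ℝ) : Plane :=
  framePoint b u (α * Real.sin θ) (f + α * Real.cos θ)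

/-- The power of `x` with respect to the rolled circle. -/
noncomputable def rollPower (α : ℝ) (b u x : Plane) (f θ : ℝ) : ℝ :=
  tcoord b u x ^ 2 + (ncoord b u x - f) ^ 2 -
    2 * α * (tcoord b u x * Real.sin θ + (ncoord b u x - f) * Real.cos θ)

section

variable {α : ℝ} {b u x : Plane} {f θ : ℝ}

lemma dist_sq_rollCenter (hu : IsUnit2 u) :
    dist x (rollCenter α b u f θ) ^ 2 = α ^ 2 + rollPower α b u x f θ := by
  rw [rollCenter, dist_sq_framePoint hu, rollPower]
  linear_combination α ^ 2 * Real.sin_sq_add_cos_sq θ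

lemma le_dist_rollCenter_iff (hu : IsUnit2 u) (hα : 0 < α) :
    α ≤ dist x (rollCenter α b u f θ) ↔ 0 ≤ rollPower α b u x f θ := by
  rw [← sq_le_sq₀ hα.le dist_nonneg, dist_sq_rollCenter hu]
  constructor <;> intro h <;> linarith

lemma dist_rollCenter_eq_iff (hu : IsUnit2 u) (hα : 0 < α) :
    dist x (rollCenter α b u f θ) = α ↔ rollPower α b u x f θ = 0 := by
  rw [← sq_eq_sq₀ dist_nonneg hα.le, dist_sq_rollCenter hu]
  constructor <;> intro h <;> linarith

lemma disjoint_rollCenter_iff (hu : IsUnit2 u) (hα : 0 < α) {T : Set Plane} :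
    Disjoint (ball (rollCenter α b u f θ) α) T ↔ ∀ x ∈ T, 0 ≤ rollPower α b u x f θ := by
  rw [Set.disjoint_right]
  refine forall₂_congr fun x _ => ?_
  rw [mem_ball, not_lt, le_dist_rollCenter_iff hu hα]

lemma dist_pivot (hu : IsUnit2 u) (hα : 0 < α) :
    dist (framePoint b u 0 f) (rollCenter α b u f θ) = α := by
  rw [dist_rollCenter_eq_iff hu hα, rollPower, tcoord_framePoint hu, ncoord_framePoint hu]
  ring

lemma turn_rollCenter (hu : IsUnit2 u) :
    turn (rollCenter α b u f θ) (framePoint b u 0 f) x =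
      α * (tcoord b u x * Real.cos θ - (ncoord b u x - f) * Real.sin θ) := by
  rw [turn_frame hu b, rollCenter, tcoord_framePoint hu, ncoord_framePoint hu,
    tcoord_framePoint hu, ncoord_framePoint hu]
  ring

lemma rollPower_add {η : ℝ} (h : rollPower α b u x f θ = 0) :
    rollPower α b u x f (θ + η) =
      (tcoord b u x ^ 2 + (ncoord b u x - f) ^ 2) * (1 - Real.cos η) -
      2 * α * (tcoord b u x * Real.cos θ - (ncoord b u x - f) * Real.sin θ) * Real.sin η := by
  unfold rollPower at *
  rw [Real.sin_add, Real.cos_add]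
  linear_combination Real.cos η * h

lemma continuous_rollPower : Continuous fun p : ℝ × ℝ => rollPower α b u x p.1 p.2 := by
  unfold rollPower; fun_prop

/-- Rotating away from a touching point keeps it outside the disc. -/
lemma rollPower_rotate_nonneg {σ η : ℝ} (hσ : σ = 1 ∨ σ = -1) (hα : 0 < α) (hη : 0 ≤ η)
    (hη' : η ≤ Real.pi) (h : rollPower α b u x f θ = 0)
    (hx : σ * (tcoord b u x * Real.cos θ - (ncoord b u x - f) * Real.sin θ) ≤ 0) :
    (tcoord b u x ^ 2 + (ncoord b u x - f) ^ 2) * (1 - Real.cos η) ≤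
      rollPower α b u x f (θ + σ * η) := by
  rw [rollPower_add h]
  have h2 := Real.sin_nonneg_of_nonneg_of_le_pi hη hη'
  rcases hσ with rfl | rfl
  · rw [one_mul] at hx ⊢
    nlinarith [mul_nonneg hα.le (mul_nonneg (neg_nonneg.2 hx) h2)]
  · rw [neg_one_mul] at hx ⊢
    rw [Real.cos_neg, Real.sin_neg]
    nlinarith [mul_nonneg hα.le (mul_nonneg (neg_nonneg.2 hx) h2)]

end

lemma abs_lt_pi_div_three_of_half_lt_cos {θ : ℝ} (h1 : |θ| ≤ Real.pi / 3)
    (h2 : 1 / 2 < Real.cos θ) : |θ| < Real.pi / 3 := by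
  refine lt_of_le_of_ne h1 fun h => ?_
  rw [← Real.cos_abs, h, Real.cos_pi_div_three] at h2
  exact lt_irrefl _ h2

namespace IsRollingSample

variable {α r ε : ℝ} {S T : Set Plane} (H : IsRollingSample α r ε S T)
include H

/-- By `center_far`, an empty disc in this parameter range is almost the exterior tangent disc. Thus
the bounds `-α` on the height and `π / 3` on the angle are never active, and extremal positions are
determined by the sample alone. -/
lemma roll_bounds {b u : Plane} (hu : IsNormal S r b u) {f θ : ℝ} (hf : -α ≤ f) (hf0 : f ≤ 0)
    (hθ : |θ| ≤ Real.pi / 3) (hc : ∀ x ∈ T, 0 ≤ rollPower α b u x f θ) :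
    -(2 * ε) < f ∧ |θ| < Real.pi / 3 ∧
      dist (rollCenter α b u f θ) (b + α • u) ≤ α * ((r - α) / r) / 300 := by
  have hα := H.alpha_pos
  have hαr := H.alpha_lt
  have hε := H.eps_pos
  have hε' := H.eps_le
  have hl := H.ratio_pos
  have hl1 := H.ratio_lt_one
  have hfar := H.center_far hu ((disjoint_rollCenter_iff hu.unit hα).2 hc)
  have hfar2 : (r + α - 2 * ε) ^ 2 < dist (rollCenter α b u f θ) (b - r • u) ^ 2 := by
    have : 0 ≤ r + α - 2 * ε := by linarith
    gcongr
  rw [sub_smul_eq_framePoint, dist_sq_framePoint hu.unit, rollCenter, tcoord_framePoint hu.unit,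
    ncoord_framePoint hu.unit] at hfar2
  have hsc := Real.sin_sq_add_cos_sq θ
  have hcos := Real.cos_le_one θ
  obtain ⟨w, hw⟩ : ∃ w, w = 1 - Real.cos θ := ⟨_, rfl⟩
  have hw0 : 0 ≤ w := by linarith
  have hcw : Real.cos θ = 1 - w := by linarith
  have hsw : Real.sin θ ^ 2 = 2 * w - w ^ 2 := by rw [hcw] at hsc; linarith
  rw [hcw, sub_zero, mul_pow, hsw] at hfar2
  have e1 : (r + α - 2 * ε) ^ 2 < (r + f + α) ^ 2 - 2 * α * (r + f) * w := by linarith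
  have hrf : 0 < r + f := by linarith
  have e2 : 0 ≤ 2 * α * (r + f) * w := by positivity
  have hf1 : -(2 * ε) < f := by
    have : r + α - 2 * ε < r + f + α := lt_of_pow_lt_pow_left₀ 2 (by linarith) (by linarith)
    linarith
  have hwε : α * w ≤ 8 * ε := by
    have k1 : 2 * α * (r + f) * w ≤ 4 * ε * (r + α) := by nlinarith
    have k2 : r / 2 ≤ r + f := by linarith
    have k3 : r * (α * w) ≤ 2 * α * (r + f) * w := by
      have : 0 ≤ α * w := by positivity
      nlinarith
    have k4 : r * (α * w) ≤ r * (8 * ε) := by nlinarith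
    exact le_of_mul_le_mul_left k4 H.r_pos
  refine ⟨hf1, abs_lt_pi_div_three_of_half_lt_cos hθ ?_, ?_⟩
  · have : w < 1 / 2 := by
      by_contra hlt
      push Not at hlt
      nlinarith
    linarith
  · apply le_of_sq_le_sq _ (by positivity)
    rw [rollCenter, add_smul_eq_framePoint, dist_sq_framePoint hu.unit, tcoord_framePoint hu.unit,
      ncoord_framePoint hu.unit, hcw, sub_zero, mul_pow, hsw]
    have k1 : α ^ 2 * (2 * w - w ^ 2) + (f + α * (1 - w) - α) ^ 2 =
      2 * α * (α * w) + f ^ 2 + 2 * (-f) * (α * w) := by ring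
    rw [k1]
    have k2 : f ^ 2 ≤ 4 * ε ^ 2 := by nlinarith
    have k3 : (-f) * (α * w) ≤ 16 * ε ^ 2 := by
      have : (-f) * (α * w) ≤ (2 * ε) * (8 * ε) := by
        apply mul_le_mul (by linarith) hwε (by positivity) (by linarith)
      linarith
    have k4 : 2 * α * (α * w) ≤ 16 * α * ε := by nlinarith
    have k5 : ε ^ 2 * 10 ^ 8 ≤ α * ε := by nlinarith
    -- The displacement of the centre is of order `√(α * ε)`. The squared ratio in `ε` makes this a
    -- multiple of `α * ((r - α) / r)`, as needed by `roll_near`.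
    have k6 : α * ε * 10 ^ 8 = (α * ((r - α) / r)) ^ 2 := by rw [H.eps_eq]; ring
    have k7 : 0 ≤ α * ε := by positivity
    rw [div_pow, ← k6]
    linarith

/-- The exterior tangent `α`-disc lies inside the exterior tangent `r`-ball, so it is an admissible
starting position. -/
lemma rollPower_zero_nonneg {b u : Plane} (hu : IsNormal S r b u) :
    ∀ x ∈ T, 0 ≤ rollPower α b u x 0 0 := by
  intro x hx
  have h1 := hu.two_mul_ncoord_le H.r_pos (H.subset hx)
  have h2 := dist_sq_base hu.unit (b := b) x
  have h3 := sq_nonneg (dist x b)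
  have hα := H.alpha_pos
  have hαr := H.alpha_lt
  rw [rollPower]
  simp only [Real.sin_zero, Real.cos_zero, sub_zero, mul_zero, mul_one, zero_add]
  rcases le_or_gt (ncoord b u x) 0 with h | h <;> nlinarith

/-- Rolling the empty disc around a fixed point of the normal line until it is blocked. -/
lemma exists_roll {b u : Plane} (hu : IsNormal S r b u) {σ : ℝ} (hσ : σ = 1 ∨ σ = -1) {f θ₁ : ℝ}
    (hf : -α ≤ f) (hf0 : f ≤ 0) (hθ : |θ₁| ≤ Real.pi / 3)
    (hc : ∀ x ∈ T, 0 ≤ rollPower α b u x f θ₁) :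
    ∃ θ, |θ| ≤ Real.pi / 3 ∧ (∀ x ∈ T, 0 ≤ rollPower α b u x f θ) ∧
      ∃ x ∈ T, rollPower α b u x f θ = 0 ∧
        0 < σ * (tcoord b u x * Real.cos θ - (ncoord b u x - f) * Real.sin θ) := by
  have hcont : ∀ x, Continuous fun θ => rollPower α b u x f θ := fun x => by
    unfold rollPower; fun_prop
  have hK : IsCompact (Icc (-(Real.pi / 3)) (Real.pi / 3) ∩
      {θ | ∀ x ∈ T, 0 ≤ rollPower α b u x f θ}) := by
    refine isCompact_Icc.inter_right ?_
    have : {θ | ∀ x ∈ T, 0 ≤ rollPower α b u x f θ} =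
        ⋂ x ∈ T, {θ | 0 ≤ rollPower α b u x f θ} := by ext; simp
    rw [this]
    exact isClosed_biInter fun x _ => isClosed_le continuous_const (hcont x)
  obtain ⟨θ, ⟨hθ1, hθ2⟩, hmax⟩ := hK.exists_isMaxOn ⟨θ₁, abs_le.1 hθ, hc⟩
    (f := fun θ => σ * θ) (by fun_prop)
  have hθ3 : |θ| ≤ Real.pi / 3 := abs_le.2 hθ1
  refine ⟨θ, hθ3, hθ2, ?_⟩
  by_contra hno
  push Not at hno
  obtain ⟨-, hlt, -⟩ := H.roll_bounds hu hf hf0 hθ3 hθ2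
  -- If no touching point lies ahead, a small further rotation stays empty: touching points are not
  -- entered, and the finitely many others stay outside by continuity. This contradicts the
  -- maximality of `σ * θ`. The pivot itself never counts as a blocker, since the blocking
  -- inequality is strict.
  have hev : ∀ᶠ η in 𝓝[>] (0 : ℝ), ∀ x ∈ T, 0 ≤ rollPower α b u x f (θ + σ * η) := by
    rw [H.finite.eventually_all]
    intro x hx
    rcases (hθ2 x hx).eq_or_lt with h0 | h0
    · filter_upwards [Ioo_mem_nhdsGT Real.pi_pos] with η hη
      refine le_trans ?_ (rollPower_rotate_nonneg hσ H.alpha_pos hη.1.le hη.2.le h0.symm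
        (hno x hx h0.symm))
      have := Real.cos_le_one η
      have : 0 ≤ 1 - Real.cos η := by linarith
      positivity
    · have : Tendsto (fun η => rollPower α b u x f (θ + σ * η)) (𝓝[>] 0)
          (𝓝 (rollPower α b u x f (θ + σ * 0))) :=
        (((hcont x).comp (by fun_prop : Continuous fun η => θ + σ * η)).tendsto 0).mono_left
          nhdsWithin_le_nhds
      rw [mul_zero, add_zero] at this
      exact (this.eventually_const_lt h0).mono fun _ h => h.le
  have hev2 : ∀ᶠ η in 𝓝[>] (0 : ℝ), |θ + σ * η| < Real.pi / 3 := by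
    have : Tendsto (fun η => |θ + σ * η|) (𝓝[>] 0) (𝓝 (|θ + σ * 0|)) :=
      ((by fun_prop : Continuous fun η => |θ + σ * η|).tendsto 0).mono_left nhdsWithin_le_nhds
    rw [mul_zero, add_zero] at this
    exact this.eventually_lt_const hlt
  obtain ⟨η, ⟨h1, h2⟩, h3⟩ := ((hev.and hev2).and self_mem_nhdsWithin).exists
  have h4 : σ * (θ + σ * η) ≤ σ * θ := hmax ⟨abs_le.1 h2.le, h1⟩
  have h5 : σ * σ = 1 := by rcases hσ with rfl | rfl <;> norm_num
  have h6 : (0 : ℝ) < η := h3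
  nlinarith

/-- The lowest empty disc through a point of the normal line is blocked on both sides. -/
lemma exists_lowest {b u : Plane} (hu : IsNormal S r b u) :
    ∃ f θ, -(2 * ε) < f ∧ f ≤ 0 ∧ |θ| ≤ Real.pi / 3 ∧
      (∀ x ∈ T, 0 ≤ rollPower α b u x f θ) ∧
      (framePoint b u 0 f ∉ T → ∀ σ : ℝ, σ = 1 ∨ σ = -1 → ∃ x ∈ T, rollPower α b u x f θ = 0 ∧
        0 < σ * (tcoord b u x * Real.cos θ - (ncoord b u x - f) * Real.sin θ)) := by
  have hα := H.alpha_pos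
  have hK : IsCompact ((Icc (-α) 0 ×ˢ Icc (-(Real.pi / 3)) (Real.pi / 3)) ∩
      {p : ℝ × ℝ | ∀ x ∈ T, 0 ≤ rollPower α b u x p.1 p.2}) := by
    refine (isCompact_Icc.prod isCompact_Icc).inter_right ?_
    have : {p : ℝ × ℝ | ∀ x ∈ T, 0 ≤ rollPower α b u x p.1 p.2} =
        ⋂ x ∈ T, {p : ℝ × ℝ | 0 ≤ rollPower α b u x p.1 p.2} := by ext; simp
    rw [this]
    exact isClosed_biInter fun x _ => isClosed_le continuous_const continuous_rollPower
  have hpi := Real.pi_pos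
  obtain ⟨⟨f, θ⟩, ⟨⟨hf, hθ⟩, hc⟩, hmin⟩ := hK.exists_isMinOn
    ⟨(0, 0), ⟨⟨⟨by simpa using hα.le, le_rfl⟩, ⟨by simp; positivity, by simp; positivity⟩⟩,
      H.rollPower_zero_nonneg hu⟩⟩ (f := fun p : ℝ × ℝ => p.1) (by fun_prop)
  simp only at hf hθ
  have hc' : ∀ x ∈ T, 0 ≤ rollPower α b u x f θ := hc
  obtain ⟨hf1, hlt, -⟩ := H.roll_bounds hu hf.1 hf.2 (abs_le.2 hθ) hc'
  refine ⟨f, θ, hf1, hf.2, abs_le.2 hθ, hc', fun hq σ hσ => ?_⟩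
  by_contra hno
  push Not at hno
  -- If one side is unblocked, a small rotation to that side detaches the disc from every sample
  -- point: the gain `|x - q|² (1 - cos η)` is positive because the pivot `q` is not a sample point.
  have hev : ∀ᶠ η in 𝓝[>] (0 : ℝ), ∀ x ∈ T, 0 < rollPower α b u x f (θ + σ * η) := by
    rw [H.finite.eventually_all]
    intro x hx
    rcases (hc' x hx).eq_or_lt with h0 | h0
    · filter_upwards [Ioo_mem_nhdsGT Real.pi_pos] with η hη
      refine lt_of_lt_of_le ?_ (rollPower_rotate_nonneg hσ H.alpha_pos hη.1.le hη.2.le h0.symm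
        (hno x hx h0.symm))
      have hcos : Real.cos η < 1 := by
        rw [← Real.cos_zero]
        exact Real.cos_lt_cos_of_nonneg_of_le_pi le_rfl hη.2.le hη.1
      refine mul_pos (lt_of_le_of_ne (by positivity) fun h => hq ?_) (by linarith)
      have e1 : tcoord b u x = 0 := by
        nlinarith [sq_nonneg (tcoord b u x), sq_nonneg (ncoord b u x - f)]
      have e2 : ncoord b u x = f := by
        nlinarith [sq_nonneg (tcoord b u x), sq_nonneg (ncoord b u x - f)]
      rw [← e1, ← e2, framePoint_coords hu.unit]
      exact hx
    · have : Tendsto (fun η => rollPower α b u x f (θ + σ * η)) (𝓝[>] 0)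
          (𝓝 (rollPower α b u x f (θ + σ * 0))) := by
        have hcont : Continuous fun η => rollPower α b u x f (θ + σ * η) := by
          unfold rollPower; fun_prop
        exact (hcont.tendsto 0).mono_left nhdsWithin_le_nhds
      rw [mul_zero, add_zero] at this
      exact this.eventually_const_lt h0
  have hev2 : ∀ᶠ η in 𝓝[>] (0 : ℝ), |θ + σ * η| < Real.pi / 3 := by
    have : Tendsto (fun η => |θ + σ * η|) (𝓝[>] 0) (𝓝 (|θ + σ * 0|)) :=
      ((by fun_prop : Continuous fun η => |θ + σ * η|).tendsto 0).mono_left nhdsWithin_le_nhds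
    rw [mul_zero, add_zero] at this
    exact this.eventually_lt_const hlt
  obtain ⟨η, h1, h2⟩ := (hev.and hev2).exists
  -- A disc detached from the whole finite sample can be lowered a little, contradicting the
  -- minimality of `f`.
  have hev3 : ∀ᶠ f' in 𝓝[<] f, ∀ x ∈ T, 0 < rollPower α b u x f' (θ + σ * η) := by
    rw [H.finite.eventually_all]
    intro x hx
    have hcont : Continuous fun f' => rollPower α b u x f' (θ + σ * η) := by
      unfold rollPower; fun_prop
    exact ((hcont.tendsto f).mono_left nhdsWithin_le_nhds).eventually_const_lt (h1 x hx)
  have hεα := H.eps_le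
  have hεp := H.eps_pos
  obtain ⟨f', h3, h4⟩ := (hev3.and (Ioo_mem_nhdsLT (show -α < f by linarith))).exists
  have h5 : f ≤ f' := hmin (a := (f', θ + σ * η))
    ⟨⟨⟨h4.1.le, h4.2.le.trans hf.2⟩, abs_le.1 h2.le⟩, fun x hx => (h3 x hx).le⟩
  linarith [h4.2]

lemma roll_near {b u : Plane} (hu : IsNormal S r b u) {f θ : ℝ} (hf : -α ≤ f) (hf0 : f ≤ 0)
    (hθ : |θ| ≤ Real.pi / 3) (hc : ∀ x ∈ T, 0 ≤ rollPower α b u x f θ) {x : Plane} (hx : x ∈ T)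
    (hx0 : rollPower α b u x f θ = 0) : dist x b ≤ α / 10 := by
  have hα := H.alpha_pos
  have hl := H.ratio_pos
  have hl1 := H.ratio_lt_one
  have hr := H.r_pos
  obtain ⟨-, -, h3⟩ := H.roll_bounds hu hf hf0 hθ hc
  have h4 := dist_sq_mul_le hα H.alpha_lt hu h3 (by nlinarith) (H.subset hx)
    ((dist_rollCenter_eq_iff hu.unit hα).2 hx0).le
  apply le_of_sq_le_sq _ (by positivity)
  have e : r - α = r * ((r - α) / r) := by field_simp
  have h5 : dist x b ^ 2 * (r - α) ≤ (α / 10) ^ 2 * (r - α) := by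
    -- With `κ = α * ((r - α) / r) / 300` the bound `3 * r * α * κ` is exactly `(α / 10) ^ 2 * (r -
    -- α)`.
    refine h4.trans_eq ?_
    field_simp
    ring
  exact le_of_mul_le_mul_right h5 (sub_pos.2 H.alpha_lt)

/-- Every end of an edge has an edge on each side. -/
lemma exists_edge_side {c₀ x y₀ : Plane} (hE : IsEdgeAt α T c₀ x y₀) {σ : ℝ}
    (hσ : σ = 1 ∨ σ = -1) : ∃ c y, IsEdgeAt α T c x y ∧ 0 < σ * turn c x y := by
  have hα := H.alpha_pos
  obtain ⟨b, hb⟩ := nearestPoints_nonempty H.frontier_compact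
    (H.frontier_nonempty ⟨x, H.subset hE.left_mem⟩) x
  obtain ⟨u, hu⟩ := H.normal b hb.1
  have h := H.nearChord hE (left_mem_segment ℝ x y₀) hb hu
  have hx0 : tcoord b u x = 0 := tcoord_eq_zero_of_nearest H.r_pos hu hb
  obtain ⟨f, hf⟩ : ∃ f, f = ncoord b u x := ⟨_, rfl⟩
  have hxf : framePoint b u 0 f = x := by rw [hf, ← hx0, framePoint_coords hu.unit]
  have hf0 : f ≤ 0 := by
    have e := eq_sub_of_nearest H.r_pos hu hb (H.subset hE.left_mem)
    rw [hf, e, sub_smul_eq_framePoint, ncoord_framePoint hu.unit]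
    simp
  have hf1 : -α ≤ f := by
    have := neg_abs_le (ncoord b u x)
    have := abs_ncoord_le hu.unit (b := b) x
    have := h.near_left
    rw [hf]; linarith
  have hcn := h.lt_ncoord_center
  have hd := dist_sq_frame hu.unit b x c₀
  rw [hE.dist_left, hx0, ← hf] at hd
  have htc : |tcoord b u c₀| ≤ α / 10 := by
    apply abs_le_of_sq_le_sq _ (by positivity)
    have h1 : dist c₀ (b + α • u) ^ 2 ≤ (α / 10) ^ 2 := by
      have := h.near_center; gcongr
    rw [add_smul_eq_framePoint, dist_sq_framePoint h.unit, sub_zero] at h1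
    nlinarith [sq_nonneg (ncoord b u c₀ - α)]
  have htc2 : |tcoord b u c₀ / α| ≤ 1 / 10 := by
    rw [abs_div, abs_of_pos hα, div_le_iff₀ hα]; linarith
  -- The given disc is written as a rolled position about the pivot `x`, so that `exists_roll` can
  -- start from it.
  obtain ⟨θ, hθ⟩ : ∃ θ, θ = Real.arcsin (tcoord b u c₀ / α) := ⟨_, rfl⟩
  have hsin : Real.sin θ = tcoord b u c₀ / α := by
    rw [hθ, Real.sin_arcsin] <;> linarith [(abs_le.1 htc2).1, (abs_le.1 htc2).2]
  have hcos : Real.cos θ = (ncoord b u c₀ - f) / α := by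
    rw [hθ, Real.cos_arcsin, Real.sqrt_eq_iff_mul_self_eq _ (div_nonneg (by linarith) hα.le)]
    · field_simp; linarith
    · nlinarith [abs_le.1 htc2]
  have hc₀ : rollCenter α b u f θ = c₀ := by
    rw [rollCenter, hsin, hcos]
    conv_rhs => rw [← framePoint_coords hu.unit (b := b) c₀]
    congr 1 <;> field_simp
    ring
  have hpi := Real.pi_pos
  have hθ3 : |θ| ≤ Real.pi / 3 := by
    have hmem : θ ∈ Icc (-(Real.pi / 2)) (Real.pi / 2) := hθ ▸ Real.arcsin_mem_Icc _
    by_contra hlt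
    push Not at hlt
    have h1 : |θ| ≤ Real.pi / 2 := abs_le.2 hmem
    have h2 : Real.cos |θ| < Real.cos (Real.pi / 3) :=
      Real.cos_lt_cos_of_nonneg_of_le_pi_div_two (by positivity) h1 hlt
    rw [Real.cos_abs, Real.cos_pi_div_three] at h2
    have h3 := Real.sin_sq_add_cos_sq θ
    have h4 : 0 ≤ Real.cos θ := Real.cos_nonneg_of_mem_Icc hmem
    rw [hsin] at h3
    nlinarith [abs_le.1 htc2]
  have hfeas : ∀ z ∈ T, 0 ≤ rollPower α b u z f θ :=
    (disjoint_rollCenter_iff hu.unit hα).1 (hc₀ ▸ hE.empty)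
  obtain ⟨θ', -, hf', y, hy, hy0, hyt⟩ := H.exists_roll hu hσ hf1 hf0 hθ3 hfeas
  have ht : 0 < σ * turn (rollCenter α b u f θ') x y := by
    rw [← hxf, turn_rollCenter hu.unit]
    nlinarith
  refine ⟨rollCenter α b u f θ', y, ⟨hE.left_mem, hy, ?_, ?_, ?_, ?_⟩, ht⟩
  · rintro rfl
    simp [turn, mul_comm] at ht
  · rw [← hxf]; exact dist_pivot hu.unit hα
  · exact (dist_rollCenter_eq_iff hu.unit hα).2 hy0
  · exact (disjoint_rollCenter_iff hu.unit hα).2 hf'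

/-- Every boundary point is the nearest boundary point of a point of some edge. -/
lemma exists_edge_over {b : Plane} (hb : b ∈ frontier S) : ∃ c x y z, IsEdgeAt α T c x y ∧
    z ∈ segment ℝ x y ∧ nearestPoints (frontier S) z = {b} := by
  have hα := H.alpha_pos
  have hαr := H.alpha_lt
  have hε := H.eps_le
  have hε' := H.eps_pos
  obtain ⟨u, hu⟩ := H.normal b hb
  obtain ⟨f, θ, hf, hf0, hθ, hc, hside⟩ := H.exists_lowest hu
  have hf1 : -α ≤ f := by linarith
  have hqt : tcoord b u (framePoint b u 0 f) = 0 := tcoord_framePoint hu.unit _ _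
  -- A pivot in the sample becomes an end of an edge after rolling. Otherwise the lowest disc
  -- touches the sample on both sides of the normal line, and the chord between the two contact
  -- points crosses that line; the crossing point `z` generally differs from the pivot.
  by_cases hq : framePoint b u 0 f ∈ T
  · obtain ⟨θ', -, hf', y, hy, hy0, hyt⟩ := H.exists_roll hu (Or.inl rfl) hf1 hf0 hθ hc
    have ht : 0 < turn (rollCenter α b u f θ') (framePoint b u 0 f) y := by
      rw [turn_rollCenter hu.unit]
      nlinarith
    refine ⟨rollCenter α b u f θ', _, y, _, ⟨hq, hy, ?_, dist_pivot hu.unit hα,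
      (dist_rollCenter_eq_iff hu.unit hα).2 hy0, (disjoint_rollCenter_iff hu.unit hα).2 hf'⟩,
      left_mem_segment ℝ _ _, ?_⟩
    · intro h
      rw [h] at ht
      simp [turn, mul_comm] at ht
    · refine nearestPoints_eq_singleton H.compact.isClosed H.r_pos hu hqt ?_
      rw [ncoord_framePoint hu.unit, abs_lt]
      constructor <;> linarith
  · obtain ⟨-, -, hcen⟩ := H.roll_bounds hu hf1 hf0 hθ hc
    have hl1 := H.ratio_lt_one
    have hcen' : dist (rollCenter α b u f θ) (b + α • u) ≤ α / 10 := by nlinarith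
    have hqb : dist (framePoint b u 0 f) b ≤ α / 10 := by
      apply le_of_sq_le_sq _ (by positivity)
      rw [dist_sq_base hu.unit, hqt, ncoord_framePoint hu.unit]
      nlinarith
    have hchord : ∀ x ∈ T, rollPower α b u x f θ = 0 →
        IsNearChord α b u (rollCenter α b u f θ) (framePoint b u 0 f) x := fun x hx hx0 =>
      ⟨hα, hu.unit, fun h => hq (h ▸ hx), dist_pivot hu.unit hα,
        (dist_rollCenter_eq_iff hu.unit hα).2 hx0, hqb, H.roll_near hu hf1 hf0 hθ hc hx hx0, hcen'⟩
    obtain ⟨x, hx, hx0, hxt⟩ := hside hq (-1) (Or.inr rfl)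
    obtain ⟨y, hy, hy0, hyt⟩ := hside hq 1 (Or.inl rfl)
    have hx1 : tcoord b u x < 0 := by
      have k := (hchord x hx hx0).symm.tcoord_lt_iff
      rw [hqt, turn_swap, turn_rollCenter hu.unit] at k
      apply k.1
      nlinarith
    have hy1 : 0 < tcoord b u y := by
      have k := (hchord y hy hy0).tcoord_lt_iff
      rw [hqt, turn_rollCenter hu.unit] at k
      apply k.1
      nlinarith
    have hD : 0 < tcoord b u y - tcoord b u x := by linarith
    have hst : tcoord b u y / (tcoord b u y - tcoord b u x) +
        -tcoord b u x / (tcoord b u y - tcoord b u x) = 1 := by field_simp; ring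
    have hz : (tcoord b u y / (tcoord b u y - tcoord b u x)) • x +
        (-tcoord b u x / (tcoord b u y - tcoord b u x)) • y ∈ segment ℝ x y :=
      ⟨_, _, div_nonneg hy1.le hD.le, div_nonneg (by linarith) hD.le, hst, rfl⟩
    refine ⟨_, x, y, _, ⟨hx, hy, ?_, (dist_rollCenter_eq_iff hu.unit hα).2 hx0,
      (dist_rollCenter_eq_iff hu.unit hα).2 hy0, (disjoint_rollCenter_iff hu.unit hα).2 hc⟩,
      hz, ?_⟩
    · rintro rfl; linarith
    · refine nearestPoints_eq_singleton H.compact.isClosed H.r_pos hu ?_ ?_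
      · rw [tcoord_combo b u x y hst]; field_simp; ring
      · refine (abs_ncoord_le hu.unit _).trans_lt ?_
        have := (convex_closedBall b (α / 10)).segment_subset
          (mem_closedBall.2 (hchord x hx hx0).near_right)
          (mem_closedBall.2 (hchord y hy hy0).near_right) hz
        rw [mem_closedBall] at this
        linarith

end IsRollingSample

/-! ### Cycles of edges and components of the `α`-shape -/

/-- A continuous bijection from a compact set onto a Hausdorff set maps components onto
components. -/
lemma image_connectedComponentIn_of_bijOn {X Y : Type*} [TopologicalSpace X] [TopologicalSpace Y]
    [T2Space Y] {C : Set X} {D : Set Y} {p : X → Y} (hC : IsCompact C) (hp : ContinuousOn p C)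
    (hb : BijOn p C D) {x : X} (hx : x ∈ C) :
    p '' connectedComponentIn C x = connectedComponentIn D (p x) := by
  have : CompactSpace C := isCompact_iff_compactSpace.1 hC
  have hcont : Continuous (hb.equiv p) := by
    apply Continuous.subtype_mk
    exact continuousOn_iff_continuous_domRestrict.1 hp
  let e : C ≃ₜ D := hcont.homeoOfEquivCompactToT2
  rw [connectedComponentIn_eq_image hx, connectedComponentIn_eq_image (hb.mapsTo hx)]
  have h1 := e.image_connectedComponentIn (s := univ) (mem_univ (⟨x, hx⟩ : C))
  rw [connectedComponentIn_univ, image_univ, e.surjective.range_eq, connectedComponentIn_univ] at h1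
  have h2 : (⟨p x, hb.mapsTo hx⟩ : D) = e ⟨x, hx⟩ := rfl
  rw [h2, ← h1, image_image, image_image]
  rfl

/-- The `α`-edge from `x` to `y`, seen counterclockwise from the centre of its empty disc. -/
def FollowsEdge (α : ℝ) (T : Set Plane) (x y : Plane) : Prop :=
  ∃ c, IsEdgeAt α T c x y ∧ 0 < turn c x y

/-- The union of the `α`-edges starting in `O`. -/
def edgesFrom (α : ℝ) (T O : Set Plane) : Set Plane :=
  {z | ∃ x y, FollowsEdge α T x y ∧ x ∈ O ∧ z ∈ segment ℝ x y}

namespace IsRollingSample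

variable {α r ε : ℝ} {S T : Set Plane} (H : IsRollingSample α r ε S T)
include H

lemma follows_right_unique {x y y' : Plane} (h : FollowsEdge α T x y)
    (h' : FollowsEdge α T x y') : y = y' := by
  obtain ⟨c, hE, ht⟩ := h
  obtain ⟨c', hE', ht'⟩ := h'
  exact H.right_unique hE hE' ht ht'

lemma follows_left_unique {x x' y : Plane} (h : FollowsEdge α T x y)
    (h' : FollowsEdge α T x' y) : x = x' := by
  obtain ⟨c, hE, ht⟩ := h
  obtain ⟨c', hE', ht'⟩ := h'
  refine H.left_unique hE.symm hE'.symm ?_ ?_ <;> rw [turn_swap] <;> linarith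

lemma exists_follows {x y : Plane} (h : FollowsEdge α T x y) : ∃ z, FollowsEdge α T y z := by
  obtain ⟨c, hE, -⟩ := h
  obtain ⟨c', z, hE', ht⟩ := H.exists_edge_side hE.symm (Or.inl rfl)
  exact ⟨z, c', hE', by simpa using ht⟩

lemma follows_or_follows {c x y : Plane} (hE : IsEdgeAt α T c x y) :
    FollowsEdge α T x y ∨ FollowsEdge α T y x := by
  rcases lt_or_gt_of_ne (H.turn_ne_zero hE) with h | h
  · exact Or.inr ⟨c, hE.symm, by rw [turn_swap]; linarith⟩
  · exact Or.inl ⟨c, hE, h⟩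

/-- In the frame at `x` the two orientations would order `x` and `y` oppositely. This excludes
cycles of length two. -/
lemma not_follows_symm {x y : Plane} (h : FollowsEdge α T x y) (h' : FollowsEdge α T y x) :
    False := by
  obtain ⟨c, hE, ht⟩ := h
  obtain ⟨c', hE', ht'⟩ := h'
  obtain ⟨b, hb⟩ := nearestPoints_nonempty H.frontier_compact
    (H.frontier_nonempty ⟨x, H.subset hE.left_mem⟩) x
  obtain ⟨u, hu⟩ := H.normal b hb.1
  have k := (H.nearChord hE (left_mem_segment ℝ x y) hb hu).tcoord_lt_iff.1 ht
  have k' := (H.nearChord hE' (right_mem_segment ℝ y x) hb hu).tcoord_lt_iff.1 ht'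
  linarith

lemma nearest_unique {c x y z : Plane} (hE : IsEdgeAt α T c x y) (hz : z ∈ segment ℝ x y) :
    ∃ b ∈ frontier S, nearestPoints (frontier S) z = {b} ∧ dist z b ≤ r / 2 := by
  obtain ⟨b, hb⟩ := nearestPoints_nonempty H.frontier_compact
    (H.frontier_nonempty ⟨x, H.subset hE.left_mem⟩) z
  obtain ⟨u, hu⟩ := H.normal b hb.1
  have h := H.nearChord hE hz hb hu
  have hd : dist z b ≤ α / 10 := by
    simpa using (convex_closedBall b (α / 10)).segment_subset (mem_closedBall.2 h.near_left)
      (mem_closedBall.2 h.near_right) hz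
  have h1 := H.alpha_pos
  have h2 := H.alpha_lt
  refine ⟨b, hb.1, ?_, by linarith⟩
  refine nearestPoints_eq_singleton H.compact.isClosed H.r_pos hu
    (tcoord_eq_zero_of_nearest H.r_pos hu hb) ?_
  have := abs_ncoord_le hu.unit (b := b) z
  linarith

/-- Two edges over the same boundary point meet over that point. -/
lemma edges_meet {x y x' y' z z' b : Plane} (h : FollowsEdge α T x y)
    (h' : FollowsEdge α T x' y') (hz : z ∈ segment ℝ x y) (hz' : z' ∈ segment ℝ x' y')
    (hb : b ∈ nearestPoints (frontier S) z) (hb' : b ∈ nearestPoints (frontier S) z') :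
    z = z' ∧ ((x' = x ∧ y' = y) ∨ ((z = x ∨ z = y) ∧ (z = x' ∨ z = y'))) := by
  obtain ⟨u, hu⟩ := H.normal b hb.1
  have hxy := h
  have hxy' := h'
  obtain ⟨c, hE, ht⟩ := h
  obtain ⟨c', hE', ht'⟩ := h'
  obtain ⟨h1, h2⟩ := H.edges_cross hE hE' (H.nearChord hE hz hb hu) (H.nearChord hE' hz' hb' hu)
    hz hz' (by rw [tcoord_eq_zero_of_nearest H.r_pos hu hb,
      tcoord_eq_zero_of_nearest H.r_pos hu hb'])
  refine ⟨h1, ?_⟩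
  rcases h2 with (h2 | ⟨rfl, rfl⟩) | h2
  · exact Or.inl h2
  · exact (H.not_follows_symm hxy hxy').elim
  · exact Or.inr h2

lemma edges_inter {x y x' y' z : Plane} (h : FollowsEdge α T x y)
    (h' : FollowsEdge α T x' y') (hz : z ∈ segment ℝ x y) (hz' : z ∈ segment ℝ x' y') :
    (x' = x ∧ y' = y) ∨ ((z = x ∨ z = y) ∧ (z = x' ∨ z = y')) := by
  have hxT : x ∈ T := h.choose_spec.1.left_mem
  obtain ⟨b, hb⟩ := nearestPoints_nonempty H.frontier_compact
    (H.frontier_nonempty ⟨x, H.subset hxT⟩) z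
  exact (H.edges_meet h h' hz hz' hb hb).2

lemma mem_alphaShape_iff {z : Plane} :
    z ∈ alphaShape α T ↔ ∃ x y, FollowsEdge α T x y ∧ z ∈ segment ℝ x y := by
  constructor
  · rintro ⟨x, y, hE, hz⟩
    obtain ⟨c, hE⟩ := isAlphaEdge_iff.1 hE
    rcases H.follows_or_follows hE with h | h
    · exact ⟨x, y, h, hz⟩
    · exact ⟨y, x, h, by rwa [segment_symm]⟩
  · rintro ⟨x, y, ⟨c, hE, -⟩, hz⟩
    exact ⟨x, y, isAlphaEdge_iff.2 ⟨c, hE⟩, hz⟩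

lemma isCompact_edgesFrom (O : Set Plane) : IsCompact (edgesFrom α T O) := by
  have e : edgesFrom α T O = ⋃ q ∈ {q : Plane × Plane | FollowsEdge α T q.1 q.2 ∧ q.1 ∈ O},
      segment ℝ q.1 q.2 := by
    ext z
    simp only [edgesFrom, mem_ofPred_eq, mem_iUnion, Prod.exists, exists_prop, and_assoc]
  rw [e]
  refine Set.Finite.isCompact_biUnion ?_ fun q _ => ?_
  · refine (H.finite.prod H.finite).subset ?_
    rintro ⟨x, y⟩ ⟨⟨c, hE, -⟩, -⟩
    exact ⟨hE.left_mem, hE.right_mem⟩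
  · rw [segment_eq_image_lineMap]
    exact isCompact_Icc.image (AffineMap.lineMap_continuous)

lemma alphaShape_eq_edgesFrom : alphaShape α T = edgesFrom α T univ := by
  ext z
  rw [H.mem_alphaShape_iff]
  simp [edgesFrom]

lemma isCompact_alphaShape : IsCompact (alphaShape α T) := by
  rw [H.alphaShape_eq_edgesFrom]; exact H.isCompact_edgesFrom univ

/-- The nearest boundary point depends continuously on the point of the `α`-shape. -/
lemma dist_nearest_le {z z' b b' : Plane} (hb : b ∈ nearestPoints (frontier S) z)
    (hb' : b' ∈ nearestPoints (frontier S) z') (hd : dist z b ≤ r / 2) (hd' : dist z' b' ≤ r / 2) :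
    dist b b' ≤ 2 * dist z z' := by
  have hr := H.r_pos
  -- The vector `z - b` is normal of length at most `r / 2`, and `2r|ncoord b'| ≤ |b' - b|²`, which
  -- gives the factor `1 / 4`. Adding the two instances yields `|b - b'|² / 2 ≤ ⟨b - b', z - z'⟩`.
  have key : ∀ {z b b' : Plane}, b ∈ nearestPoints (frontier S) z → b' ∈ frontier S →
      dist z b ≤ r / 2 →
      (b' 0 - b 0) * (z 0 - b 0) + (b' 1 - b 1) * (z 1 - b 1) ≤ dist b' b ^ 2 / 4 := by
    intro z b b' hb hb' hd
    obtain ⟨u, hu⟩ := H.normal b hb.1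
    have h0 := tcoord_eq_zero_of_nearest hr hu hb
    have e : (b' 0 - b 0) * (z 0 - b 0) + (b' 1 - b 1) * (z 1 - b 1) =
        tcoord b u b' * tcoord b u z + ncoord b u b' * ncoord b u z := by
      have := hu.unit
      unfold IsUnit2 at this
      simp only [tcoord, ncoord]
      linear_combination -((b' 0 - b 0) * (z 0 - b 0) + (b' 1 - b 1) * (z 1 - b 1)) * this
    rw [e, h0, mul_zero, zero_add]
    have h1 := hu.two_mul_ncoord_le hr (H.compact.isClosed.frontier_subset hb')
    have h2 := hu.neg_two_mul_ncoord_le hr hb'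
    have h3 : 2 * r * |ncoord b u b'| ≤ dist b' b ^ 2 := by
      rcases abs_cases (ncoord b u b') with ⟨h1, _⟩ | ⟨h1, _⟩ <;> rw [h1] <;> linarith
    have h4 : |ncoord b u z| ≤ r / 2 := (abs_ncoord_le hu.unit z).trans hd
    have h5 := le_abs_self (ncoord b u b' * ncoord b u z)
    rw [abs_mul] at h5
    nlinarith [abs_nonneg (ncoord b u b')]
  have k1 := key hb hb'.1 hd
  have k2 := key hb' hb.1 hd'
  have e1 := dist_sq_plane b b'
  have e2 := dist_sq_plane z z'
  rw [dist_comm b' b] at k1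
  have k3 : dist b b' ^ 2 / 2 ≤ (b 0 - b' 0) * (z 0 - z' 0) + (b 1 - b' 1) * (z 1 - z' 1) := by
    nlinarith
  apply le_of_sq_le_sq _ (by positivity)
  nlinarith [sq_nonneg (b 0 - b' 0 - 2 * (z 0 - z' 0)), sq_nonneg (b 1 - b' 1 - 2 * (z 1 - z' 1))]

/-- Each component of the `α`-shape is a simple polygon. -/
lemma exists_polygon {x : Plane} (hx : x ∈ alphaShape α T) :
    ∃ (m : ℕ) (Q : Polygon Plane m), IsSimplePolygon Q ∧
      (∀ i, IsAlphaEdge α T (Q i) (Q (finRotate m i))) ∧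
      connectedComponentIn (alphaShape α T) x = Q.boundary ℝ := by
  classical
  let V := {v : Plane // ∃ w, FollowsEdge α T v w}
  have hVT : ∀ v : V, (v : Plane) ∈ T := fun v => by
    obtain ⟨w, c, hE, -⟩ := v.2
    exact hE.left_mem
  have : Finite T := H.finite
  have : Finite V := Finite.of_injective (fun v : V => (⟨v, hVT v⟩ : T)) fun v w h =>
    Subtype.ext (congrArg (fun t : T => (t : Plane)) h)
  let f : V → V := fun v => ⟨v.2.choose, H.exists_follows v.2.choose_spec⟩
  have hf : ∀ v : V, FollowsEdge α T v (f v) := fun v => v.2.choose_spec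
  have hinj : Function.Injective f := fun v w h => by
    have h1 := hf v
    rw [h] at h1
    exact Subtype.ext (H.follows_left_unique h1 (hf w))
  obtain ⟨v', w, hvw, hxs⟩ := H.mem_alphaShape_iff.1 hx
  obtain ⟨v, rfl⟩ : ∃ v : V, (v : Plane) = v' := ⟨⟨v', w, hvw⟩, rfl⟩
  obtain rfl : (f v : Plane) = w := H.follows_right_unique (hf v) hvw
  -- An injective self-map of a finite set has only periodic points; the orbit of `v` lists the
  -- vertices of the polygon.
  have hper := hinj.mem_periodicPts v
  obtain ⟨m, hm⟩ : ∃ m, m = Function.minimalPeriod f v := ⟨_, rfl⟩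
  have hm0 : 0 < m := hm ▸ Function.minimalPeriod_pos_of_mem_periodicPts hper
  have hne : ∀ v, f v ≠ v := fun v h => by
    obtain ⟨c, hE, -⟩ := hf v
    exact hE.ne (congrArg Subtype.val h).symm
  have hne2 : ∀ v, f (f v) ≠ v := fun v h => by
    have h1 := hf (f v)
    rw [h] at h1
    exact H.not_follows_symm (hf v) h1
  have hmv : f^[m] v = v := by rw [hm]; exact Function.iterate_minimalPeriod
  have hmod : ∀ n, f^[n % m] v = f^[n] v := fun n => by
    rw [hm]; exact Function.iterate_mod_minimalPeriod_eq
  have hm3 : 3 ≤ m := by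
    by_contra hlt
    have : m = 1 ∨ m = 2 := by lia
    rcases this with h | h
    · rw [h] at hmv; exact hne v hmv
    · rw [h] at hmv; exact hne2 v hmv
  let Q : Polygon Plane m := ⟨fun i => (f^[(i : ℕ)] v : V)⟩
  have hQ : ∀ i : Fin m, Q i = (f^[(i : ℕ)] v : V) := fun _ => rfl
  have hQ' : ∀ i : Fin m, Q (finRotate m i) = (f (f^[(i : ℕ)] v) : V) := by
    intro i
    have : NeZero m := ⟨hm0.ne'⟩
    rw [hQ, ← Function.iterate_succ_apply' f, finRotate_apply, Fin.val_add]
    rw [Fin.val_one', Nat.add_mod_mod, hmod]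
  have hFol : ∀ i : Fin m, FollowsEdge α T (Q i) (Q (finRotate m i)) := by
    intro i
    rw [hQ']
    exact hf _
  have hedge : ∀ i : Fin m, Q.edgeSet ℝ i = segment ℝ (Q i) (Q (finRotate m i)) := fun i => by
    rw [Polygon.edgeSet, affineSegment_eq_segment]
  have hQinj : Function.Injective Q.vertices := by
    intro i j hij
    apply Fin.ext
    have h1 : f^[(i : ℕ)] v = f^[(j : ℕ)] v := Subtype.ext hij
    exact Function.iterate_injOn_Iio_minimalPeriod (hm ▸ i.2) (hm ▸ j.2) h1
  refine ⟨m, Q, ⟨hm3, hQinj, ?_⟩, ?_, ?_⟩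
  · rintro i j hij z ⟨hz, hz'⟩
    rw [hedge] at hz hz'
    rcases H.edges_inter (hFol i) (hFol j) hz hz' with h | h
    · exact absurd (hQinj h.1.symm) hij
    · exact h
  · intro i
    obtain ⟨c, hE, -⟩ := hFol i
    exact isAlphaEdge_iff.2 ⟨c, hE⟩
  · let O : Set Plane := {z | ∃ n : ℕ, z = (f^[n] v : V)}
    have hbd : Q.boundary ℝ = edgesFrom α T O := by
      ext z
      simp only [Polygon.boundary, mem_iUnion, hedge]
      constructor
      · rintro ⟨i, hz⟩
        exact ⟨_, _, hFol i, ⟨i, hQ i⟩, hz⟩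
      · rintro ⟨a, b, hab, ⟨n, rfl⟩, hz⟩
        obtain rfl := H.follows_right_unique (hf _) hab
        refine ⟨⟨n % m, Nat.mod_lt _ hm0⟩, ?_⟩
        rw [hQ', hQ]
        simp only
        rwa [hmod]
    have hchain : edgesFrom α T O = ⋃ n : ℕ, segment ℝ (f^[n] v : Plane) (f (f^[n] v) : Plane) := by
      ext z
      rw [mem_iUnion]
      constructor
      · rintro ⟨a, b, hab, ⟨n, rfl⟩, hz⟩
        obtain rfl := H.follows_right_unique (hf _) hab
        exact ⟨n, hz⟩
      · rintro ⟨n, hz⟩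
        exact ⟨_, _, hf _, ⟨n, rfl⟩, hz⟩
    have hconn : IsPreconnected (edgesFrom α T O) := by
      rw [hchain]
      refine IsPreconnected.iUnion_of_chain (fun n => (convex_segment _ _).isPreconnected)
        fun n => ⟨(f (f^[n] v) : V), right_mem_segment ℝ _ _, ?_⟩
      rw [Nat.succ_eq_succ, Nat.succ_eq_add_one, Function.iterate_succ_apply']
      exact left_mem_segment ℝ _ _
    have hsub : edgesFrom α T O ⊆ alphaShape α T := by
      rw [H.alphaShape_eq_edgesFrom]
      rintro z ⟨a, b, hab, -, hz⟩
      exact ⟨a, b, hab, mem_univ _, hz⟩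
    have hxO : x ∈ edgesFrom α T O := ⟨_, _, hf v, ⟨0, rfl⟩, hxs⟩
    have hback : ∀ {a b}, FollowsEdge α T a b → b ∈ O → a ∈ O := by
      rintro a b hab ⟨n, rfl⟩
      obtain ⟨k, hk⟩ : ∃ k, f (f^[k] v) = f^[n] v := by
        -- Going once around the cycle, short of one step, reaches the predecessor; adding `m`
        -- avoids the case `n = 0`.
        refine ⟨n + (m - 1), ?_⟩
        rw [← Function.iterate_succ_apply' f, show (n + (m - 1)).succ = n + m by lia,
          Function.iterate_add_apply, hmv]
      have h1 := hf (f^[k] v)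
      rw [hk] at h1
      exact ⟨k, H.follows_left_unique hab h1⟩
    have hforw : ∀ {a b}, FollowsEdge α T a b → a ∈ O → b ∈ O := by
      rintro a b hab ⟨n, rfl⟩
      refine ⟨n + 1, ?_⟩
      rw [Function.iterate_succ_apply']
      exact H.follows_right_unique hab (hf _)
    rw [hbd]
    apply Subset.antisymm _ (hconn.subset_connectedComponentIn hxO hsub)
    have hcover : connectedComponentIn (alphaShape α T) x ⊆ edgesFrom α T O ∪ edgesFrom α T Oᶜ := by
      refine (connectedComponentIn_subset _ _).trans ?_
      rw [H.alphaShape_eq_edgesFrom]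
      rintro z ⟨a, b, hab, -, hz⟩
      by_cases ha : a ∈ O
      · exact Or.inl ⟨a, b, hab, ha, hz⟩
      · exact Or.inr ⟨a, b, hab, ha, hz⟩
    -- Different edges meet only in common ends, and the orbit `O` is closed under successors and
    -- predecessors. The edges inside and outside the orbit thus form two disjoint closed sets
    -- covering the shape, so the component cannot leave the orbit.
    have hdisj : edgesFrom α T O ∩ edgesFrom α T Oᶜ = ∅ := by
      rw [eq_empty_iff_forall_notMem]
      rintro z ⟨⟨a, b, hab, ha, hz⟩, ⟨a', b', hab', ha', hz'⟩⟩
      have hb := hforw hab ha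
      have hb' : b' ∉ O := fun h => ha' (hback hab' h)
      rcases H.edges_inter hab hab' hz hz' with h | ⟨h1, h2⟩
      · exact ha' (h.1 ▸ ha)
      · have hzO : z ∈ O := by rcases h1 with rfl | rfl <;> assumption
        rcases h2 with rfl | rfl
        · exact ha' hzO
        · exact hb' hzO
    rcases isPreconnected_iff_subset_of_disjoint_closed.1 isPreconnected_connectedComponentIn
      _ _ (H.isCompact_edgesFrom O).isClosed (H.isCompact_edgesFrom Oᶜ).isClosed hcover
      (by rw [hdisj, inter_empty]) with h | h
    · exact h
    · have : x ∈ edgesFrom α T O ∩ edgesFrom α T Oᶜ := ⟨hxO, h (mem_connectedComponentIn hx)⟩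
      rw [hdisj] at this
      exact this.elim

/-- The structure of the `α`-shape of a rolling sample. -/
theorem alphaShape_structure : ∃ p : Plane → Plane,
    IsMetricProjectionOn (frontier S) (alphaShape α T) p ∧
    BijOn p (alphaShape α T) (frontier S) ∧
    ∀ x ∈ alphaShape α T,
      (∃ (m : ℕ) (Q : Polygon Plane m), IsSimplePolygon Q ∧
        (∀ i, IsAlphaEdge α T (Q i) (Q (finRotate m i))) ∧
        connectedComponentIn (alphaShape α T) x = Q.boundary ℝ) ∧
      p '' connectedComponentIn (alphaShape α T) x = connectedComponentIn (frontier S) (p x) := by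
  have hex : ∀ z ∈ alphaShape α T,
      ∃ b ∈ frontier S, nearestPoints (frontier S) z = {b} ∧ dist z b ≤ r / 2 := by
    rintro z ⟨x, y, hE, hz⟩
    obtain ⟨c, hE⟩ := isAlphaEdge_iff.1 hE
    exact H.nearest_unique hE hz
  choose! p hpm hp hpd using hex
  have hpn : ∀ z ∈ alphaShape α T, p z ∈ nearestPoints (frontier S) z := fun z hz => by
    rw [hp z hz]; exact mem_singleton _
  have hcont : ContinuousOn p (alphaShape α T) := by
    refine LipschitzOnWith.continuousOn (K := 2) (LipschitzOnWith.of_dist_le_mul fun z hz z' hz' => ?_)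
    exact H.dist_nearest_le (hpn z hz) (hpn z' hz') (hpd z hz) (hpd z' hz')
  have hbij : BijOn p (alphaShape α T) (frontier S) := by
    refine ⟨hpm, fun z hz z' hz' heq => ?_, fun b hb => ?_⟩
    · obtain ⟨x, y, h, hs⟩ := H.mem_alphaShape_iff.1 hz
      obtain ⟨x', y', h', hs'⟩ := H.mem_alphaShape_iff.1 hz'
      exact (H.edges_meet h h' hs hs' (hpn z hz) (heq ▸ hpn z' hz')).1
    · obtain ⟨c, x, y, z, hE, hz, hn⟩ := H.exists_edge_over hb
      have hzC : z ∈ alphaShape α T := ⟨x, y, isAlphaEdge_iff.2 ⟨c, hE⟩, hz⟩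
      refine ⟨z, hzC, ?_⟩
      rw [hp z hzC] at hn
      exact singleton_injective hn
  exact ⟨p, hp, hbij, fun x hx => ⟨H.exists_polygon hx,
    image_connectedComponentIn_of_bijOn H.isCompact_alphaShape hcont hbij hx⟩⟩

end IsRollingSample

/-! ### Genericity and sampling probabilities -/

/-- The centres of the two circles of radius `α` through two points. -/
noncomputable def circleCenter (α σ : ℝ) (q : Plane × Plane) : Plane :=
  (1 / 2 : ℝ) • (q.1 + q.2) +
    (σ * √(α ^ 2 / dist q.1 q.2 ^ 2 - 1 / 4)) • rot (q.2 - q.1)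

lemma continuous_rot : Continuous rot := by
  unfold rot
  fun_prop

lemma measurable_circleCenter (α σ : ℝ) : Measurable (circleCenter α σ) := by
  unfold circleCenter
  have h := continuous_rot.measurable
  fun_prop

lemma eq_circleCenter {α : ℝ} {x y c : Plane} (hxy : x ≠ y) (hx : dist x c = α)
    (hy : dist y c = α) : c = circleCenter α 1 (x, y) ∨ c = circleCenter α (-1) (x, y) := by
  have hD : 0 < dist x y ^ 2 := by have := dist_pos.2 hxy; positivity
  have e1 := dist_sq_plane x c
  have e2 := dist_sq_plane y c
  have e3 := dist_sq_plane x y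
  rw [hx] at e1
  rw [hy] at e2
  set D := dist x y ^ 2
  -- The centre lies on the perpendicular bisector, and `k` is its signed offset from the midpoint
  -- in units of `rot (y - x)`. The radius determines `k ^ 2`, hence `k` up to sign.
  obtain ⟨k, hk⟩ : ∃ k, k * D = (c 0 - (x 0 + y 0) / 2) * (y 1 - x 1) -
      (c 1 - (x 1 + y 1) / 2) * (y 0 - x 0) :=
    ⟨((c 0 - (x 0 + y 0) / 2) * (y 1 - x 1) - (c 1 - (x 1 + y 1) / 2) * (y 0 - x 0)) / D,
      div_mul_cancel₀ _ hD.ne'⟩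
  have h0 : (c 0 - (x 0 + y 0) / 2) * (y 0 - x 0) + (c 1 - (x 1 + y 1) / 2) * (y 1 - x 1) = 0 := by
    linarith
  have c0 : c 0 = (x 0 + y 0) / 2 + k * (y 1 - x 1) := by
    have : D * (c 0 - (x 0 + y 0) / 2 - k * (y 1 - x 1)) = 0 := by
      linear_combination (c 0 - (x 0 + y 0) / 2) * e3 - (y 1 - x 1) * hk + (y 0 - x 0) * h0
    have := (mul_eq_zero.1 this).resolve_left hD.ne'
    linarith
  have c1 : c 1 = (x 1 + y 1) / 2 - k * (y 0 - x 0) := by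
    have : D * (c 1 - (x 1 + y 1) / 2 + k * (y 0 - x 0)) = 0 := by
      linear_combination (c 1 - (x 1 + y 1) / 2) * e3 + (y 0 - x 0) * hk + (y 1 - x 1) * h0
    have := (mul_eq_zero.1 this).resolve_left hD.ne'
    linarith
  have hk2 : α ^ 2 / D - 1 / 4 = k ^ 2 := by
    rw [c0, c1] at e1
    have : α ^ 2 = (k ^ 2 + 1 / 4) * D := by linear_combination e1 - (k ^ 2 + 1 / 4) * e3
    rw [this]; field_simp; ring
  have hs : √(α ^ 2 / D - 1 / 4) = |k| := by rw [hk2, Real.sqrt_sq_eq_abs]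
  rcases abs_cases k with ⟨h, -⟩ | ⟨h, -⟩
  · left
    apply plane_ext <;> simp only [circleCenter, rot, PiLp.add_apply, PiLp.smul_apply, smul_eq_mul,
      PiLp.sub_apply, Matrix.cons_val_zero, Matrix.cons_val_one]
    · rw [hs, h, c0]; ring
    · rw [hs, h, c1]; ring
  · right
    apply plane_ext <;> simp only [circleCenter, rot, PiLp.add_apply, PiLp.smul_apply, smul_eq_mul,
      PiLp.sub_apply, Matrix.cons_val_zero, Matrix.cons_val_one]
    · rw [hs, h, c0]; ring
    · rw [hs, h, c1]; ring

section probability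

variable {Ω : Type*} [MeasurableSpace Ω] {P : Measure Ω} [IsProbabilityMeasure P]

/-- A point with absolutely continuous law almost surely avoids a circle determined by an
independent variable. -/
lemma measure_dist_eq_zero {β : Type*} [MeasurableSpace β] {W : Ω → β} {Z : Ω → Plane}
    (hW : Measurable W) (hZ : Measurable Z) (hWZ : IndepFun W Z P)
    (hac : P.map Z ≪ volume) {g : β → Plane} (hg : Measurable g) {α : ℝ} (hα : 0 < α) :
    P {ω | dist (Z ω) (g (W ω)) = α} = 0 := by
  have hB : MeasurableSet {q : β × Plane | dist q.2 (g q.1) = α} := by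
    refine measurableSet_eq_fun ?_ measurable_const
    fun_prop
  have hmap := (indepFun_iff_map_prod_eq_prod_map_map hW.aemeasurable hZ.aemeasurable).1 hWZ
  have h1 : P {ω | dist (Z ω) (g (W ω)) = α} =
      P.map (fun ω => (W ω, Z ω)) {q : β × Plane | dist q.2 (g q.1) = α} := by
    rw [Measure.map_apply (hW.prodMk hZ) hB]; rfl
  have := Measure.isProbabilityMeasure_map hZ.aemeasurable (μ := P)
  rw [h1, hmap, Measure.measure_prod_null hB]
  refine Eventually.of_forall fun w => hac ?_
  exact Measure.addHaar_sphere_of_ne_zero volume (g w) hα.ne'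

variable {S : Set Plane}

lemma volume_ne_zero_of_isUniform {X : Ω → Plane} (hX : Measurable X)
    (hu : pdf.IsUniform X S P volume) : volume S ≠ 0 := by
  intro h0
  have := Measure.isProbabilityMeasure_map hX.aemeasurable (μ := P)
  have h1 : P.map X = cond volume S := hu
  rw [cond_eq_zero_of_meas_eq_zero h0] at h1
  exact IsProbabilityMeasure.ne_zero (P.map X) h1

lemma measure_not_mem_of_isUniform (hS : IsCompact S) {X : Ω → Plane} (hX : Measurable X)
    (hu : pdf.IsUniform X S P volume) : P (X ⁻¹' Sᶜ) = 0 := by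
  rw [hu.measure_preimage (volume_ne_zero_of_isUniform hX hu) hS.measure_lt_top.ne
    hS.measurableSet.compl]
  simp

/-- The probability that an independent uniform sample misses a given subset. -/
lemma measure_miss_le (hS : IsCompact S) {n : ℕ} {X : Fin n → Ω → Plane}
    (hX : ∀ i, Measurable (X i)) (hind : iIndepFun X P)
    (hu : ∀ i, pdf.IsUniform (X i) S P volume) {D : Set Plane} (hD : MeasurableSet D)
    (hDS : D ⊆ S) {p v : ℝ} (hv : volume.real S ≤ v) (hp : p = volume.real D / v) :
    P.real (⋂ i, X i ⁻¹' Dᶜ) ≤ Real.exp (-(n * p)) := by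
  have h1 : P (⋂ i, X i ⁻¹' Dᶜ) = ∏ i, P (X i ⁻¹' Dᶜ) := by
    have := hind.measure_inter_preimage_eq_mul Finset.univ (sets := fun _ => Dᶜ)
      (fun i _ => hD.compl)
    simpa using this
  have h2 : ∀ i, P.real (X i ⁻¹' Dᶜ) ≤ Real.exp (-p) := by
    intro i
    have hne := volume_ne_zero_of_isUniform (hX i) (hu i)
    have hpos : 0 < volume.real S := ENNReal.toReal_pos hne hS.measure_lt_top.ne
    have h3 : P.real (X i ⁻¹' D) = volume.real D / volume.real S := by
      rw [measureReal_def, (hu i).measure_preimage hne hS.measure_lt_top.ne hD,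
        inter_eq_self_of_subset_right hDS, ENNReal.toReal_div]
      rfl
    have h4 : p ≤ P.real (X i ⁻¹' D) := by
      rw [h3, hp]
      exact div_le_div_of_nonneg_left measureReal_nonneg hpos hv
    -- Each point misses `D` with probability at most `1 - p ≤ exp (-p)`.
    rw [preimage_compl, probReal_compl_eq_one_sub (hX i hD)]
    have := Real.add_one_le_exp (-p)
    linarith
  rw [measureReal_def, h1, ENNReal.toReal_prod]
  calc ∏ i, (P (X i ⁻¹' Dᶜ)).toReal ≤ ∏ _i : Fin n, Real.exp (-p) :=
        Finset.prod_le_prod (fun i _ => ENNReal.toReal_nonneg) fun i _ => h2 i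
    _ = Real.exp (-(n * p)) := by
        rw [Finset.prod_const, Finset.card_univ, Fintype.card_fin, ← Real.exp_nat_mul]
        congr 1; ring

end probability

/-! ### Choice of the constant and of the good event -/

theorem mainTheorem2 (α r d : ℝ) (hα : 0 < α) (hαr : α < r) :
    ∃ A : ℝ, 0 < A ∧
      ∀ S : Set Plane, IsCompact S → RollingCondition r S → RollingCondition r Sᶜ →
        Metric.diam S = d →
      ∀ (n : ℕ) (Ω : Type*) [MeasurableSpace Ω] (P : MeasureTheory.Measure Ω)
        [MeasureTheory.IsProbabilityMeasure P] (X : Fin n → Ω → Plane),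
        (∀ i, Measurable (X i)) →
        ProbabilityTheory.iIndepFun X P →
        (∀ i, MeasureTheory.pdf.IsUniform (X i) S P MeasureTheory.volume) →
        -- an event of probability at least `1 - A * exp (-n / A)` on which the conclusion holds
        ∃ E : Set Ω, MeasurableSet E ∧ 1 - A * Real.exp (-(n : ℝ) / A) ≤ P.real E ∧
          ∀ ω ∈ E, ∃ p : Plane → Plane,
            -- `p` is the metric projection onto `∂S` on the `α`-shape of the sample
            IsMetricProjectionOn (frontier S) (alphaShape α (Set.range fun i => X i ω)) p ∧
            Set.BijOn p (alphaShape α (Set.range fun i => X i ω)) (frontier S) ∧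
            -- each component of the `α`-shape is a simple polygon whose edges are `α`-edges,
            -- and it projects onto one component of `∂S`
            ∀ x ∈ alphaShape α (Set.range fun i => X i ω),
              (∃ (m : ℕ) (Q : Polygon Plane m), IsSimplePolygon Q ∧
                (∀ i, IsAlphaEdge α (Set.range fun j => X j ω) (Q i) (Q (finRotate m i))) ∧
                connectedComponentIn (alphaShape α (Set.range fun i => X i ω)) x
                  = Q.boundary ℝ) ∧
              p '' connectedComponentIn (alphaShape α (Set.range fun i => X i ω)) x
                = connectedComponentIn (frontier S) (p x) := by
  have hr : 0 < r := hα.trans hαr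
  obtain ⟨ε, hε⟩ : ∃ ε, ε = α * ((r - α) / r) ^ 2 / 10 ^ 8 := ⟨_, rfl⟩
  have hε0 : 0 < ε := by
    have := div_pos (sub_pos.2 hαr) hr
    rw [hε]; positivity
  -- The cover is fixed before `S` is given; it is later translated to a ball of radius `d` about a
  -- point `s₀` that contains `S`.
  obtain ⟨F, -, hFfin, hF⟩ :=
    (isCompact_closedBall (0 : Plane) d).finite_cover_balls (half_pos hε0)
  -- The added `1` keeps `v` positive even when the closed ball has volume zero, as `d` may be
  -- nonpositive.
  obtain ⟨v, hv⟩ : ∃ v, v = volume.real (closedBall (0 : Plane) d) + 1 := ⟨_, rfl⟩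
  have hv0 : 0 < v := by rw [hv]; positivity
  obtain ⟨p, hp⟩ : ∃ p, p = volume.real (ball (0 : Plane) (ε / 2)) / v := ⟨_, rfl⟩
  have hp0 : 0 < p := by
    rw [hp]
    exact div_pos (ENNReal.toReal_pos (measure_ball_pos volume _ (half_pos hε0)).ne'
      measure_ball_lt_top.ne) hv0
  obtain ⟨N, hN⟩ : ∃ N : ℕ, N = hFfin.toFinset.card := ⟨_, rfl⟩
  -- The summand `N` absorbs the number of balls in the union bound, and `1 / p` ensures `1 / A ≤
  -- p`, so that `exp (-(n * p)) ≤ exp (-n / A)`.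
  refine ⟨N + 1 / p + 1, by positivity, ?_⟩
  intro S hS hroll hroll' hdiam n Ω _ P _ X hX hind hu
  obtain ⟨s₀, hs₀⟩ : ∃ s₀, S ⊆ closedBall s₀ d := by
    rcases S.eq_empty_or_nonempty with rfl | ⟨s, hs⟩
    · exact ⟨0, empty_subset _⟩
    · exact ⟨s, fun x hx => mem_closedBall.2 (hdiam ▸ dist_le_diam_of_mem hS.isBounded hx hs)⟩
  have hvS : volume.real S ≤ v := by
    have h1 : volume.real S ≤ volume.real (closedBall s₀ d) :=
      measureReal_mono hs₀ measure_closedBall_lt_top.ne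
    have h2 : volume.real (closedBall s₀ d) = volume.real (closedBall (0 : Plane) d) := by
      rw [measureReal_def, measureReal_def, Measure.addHaar_closedBall_center]
    linarith
  let B : Plane → Set Plane := fun w => ball (s₀ + w) (ε / 2)
  let J : Set Plane := {w | w ∈ F ∧ B w ⊆ S}
  have hJfin : J.Finite := hFfin.subset fun w hw => hw.1
  have hpB : ∀ w, p = volume.real (B w) / v := fun w => by
    rw [hp, measureReal_def, measureReal_def, Measure.addHaar_ball_center volume (s₀ + w)]
  let E₁ : Set Ω := ⋂ i, X i ⁻¹' S
  -- The first two indices may coincide: `circleCenter` is a total measurable function, so only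
  -- independence of the third point from the first two matters.
  let E₂ : Set Ω := ⋂ q ∈ {q : Fin n × Fin n × Fin n | q.1 ≠ q.2.2 ∧ q.2.1 ≠ q.2.2},
    ⋂ σ ∈ ({1, -1} : Set ℝ),
      {ω | dist (X q.2.2 ω) (circleCenter α σ (X q.1 ω, X q.2.1 ω)) = α}ᶜ
  let E₃ : Set Ω := ⋂ w ∈ J, (⋂ i, X i ⁻¹' (B w)ᶜ)ᶜ
  have hmeas₁ : MeasurableSet E₁ := MeasurableSet.iInter fun i => hX i hS.measurableSet
  have hmeas₂ : MeasurableSet E₂ := by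
    refine MeasurableSet.biInter (to_countable _) fun q _ =>
      MeasurableSet.biInter (to_countable _) fun σ _ => MeasurableSet.compl ?_
    refine measurableSet_eq_fun ?_ measurable_const
    exact (hX _).dist ((measurable_circleCenter α σ).comp ((hX _).prodMk (hX _)))
  have hmeas₃ : MeasurableSet E₃ := MeasurableSet.biInter hJfin.countable fun w _ =>
    (MeasurableSet.iInter fun i => hX i measurableSet_ball.compl).compl
  have hnull₁ : P E₁ᶜ = 0 := by
    rw [compl_iInter, measure_iUnion_null_iff]
    exact fun i => measure_not_mem_of_isUniform hS (hX i) (hu i)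
  have hnull₂ : P E₂ᶜ = 0 := by
    simp only [E₂, compl_iInter, compl_compl]
    refine (measure_biUnion_null_iff (to_countable _)).2 fun q hq =>
      (measure_biUnion_null_iff (to_countable _)).2 fun σ _ => ?_
    exact measure_dist_eq_zero ((hX q.1).prodMk (hX q.2.1)) (hX q.2.2)
      (hind.indepFun_prodMk hX q.1 q.2.1 q.2.2 hq.1 hq.2) (hu q.2.2).absolutelyContinuous
      (measurable_circleCenter α σ) hα
  have hbound₃ : P.real E₃ᶜ ≤ N * Real.exp (-(n * p)) := by
    have e : E₃ᶜ = ⋃ w ∈ hJfin.toFinset, ⋂ i, X i ⁻¹' (B w)ᶜ := by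
      ext ω
      simp [E₃]
    rw [e]
    calc P.real (⋃ w ∈ hJfin.toFinset, ⋂ i, X i ⁻¹' (B w)ᶜ)
        ≤ ∑ w ∈ hJfin.toFinset, P.real (⋂ i, X i ⁻¹' (B w)ᶜ) :=
          measureReal_biUnion_finset_le _ _
      _ ≤ ∑ w ∈ hJfin.toFinset, Real.exp (-(n * p)) := by
          refine Finset.sum_le_sum fun w hw => ?_
          rw [Finite.mem_toFinset] at hw
          exact measure_miss_le hS hX hind hu measurableSet_ball hw.2 hvS (hpB w)
      _ = hJfin.toFinset.card * Real.exp (-(n * p)) := by rw [Finset.sum_const, nsmul_eq_mul]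
      _ ≤ N * Real.exp (-(n * p)) := by
          gcongr
          rw [hN]
          refine Finset.card_le_card fun w hw => ?_
          rw [Finite.mem_toFinset] at hw ⊢
          exact hw.1
  refine ⟨E₁ ∩ E₂ ∩ E₃, (hmeas₁.inter hmeas₂).inter hmeas₃, ?_, ?_⟩
  · have h1 : P.real (E₁ ∩ E₂ ∩ E₃)ᶜ ≤ N * Real.exp (-(n * p)) := by
      rw [compl_inter, compl_inter]
      have k1 := measureReal_union_le (μ := P) (E₁ᶜ ∪ E₂ᶜ) E₃ᶜ
      have k2 := measureReal_union_le (μ := P) E₁ᶜ E₂ᶜ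
      have k3 : P.real E₁ᶜ = 0 := by rw [measureReal_def, hnull₁]; rfl
      have k4 : P.real E₂ᶜ = 0 := by rw [measureReal_def, hnull₂]; rfl
      linarith
    rw [probReal_compl_eq_one_sub ((hmeas₁.inter hmeas₂).inter hmeas₃)] at h1
    have h2 : (N : ℝ) * Real.exp (-(n * p)) ≤
        (N + 1 / p + 1) * Real.exp (-(n : ℝ) / (N + 1 / p + 1)) := by
      have hp' : 0 < 1 / p := by positivity
      have hA : 1 / (N + 1 / p + 1) ≤ p := by
        rw [div_le_iff₀ (by positivity)]
        have : p * (1 / p) = 1 := by field_simp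
        nlinarith [mul_nonneg hp0.le (Nat.cast_nonneg (α := ℝ) N)]
      apply mul_le_mul (by linarith) _ (Real.exp_pos _).le (by positivity)
      apply Real.exp_le_exp.2
      rw [neg_div, neg_le_neg_iff, div_eq_mul_one_div]
      gcongr
    linarith
  · rintro ω ⟨⟨h1, h2⟩, h3⟩
    have H : IsRollingSample α r ε S (Set.range fun i => X i ω) := by
      refine ⟨hα, hαr, hε, hS, fun b hb => exists_isNormal hr hroll hroll' hb,
        finite_range _, ?_, ?_, ?_⟩
      · rintro _ ⟨i, rfl⟩
        exact mem_iInter.1 h1 i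
      · intro z hz
        have hzS : z ∈ S := hz (mem_ball_self hε0)
        have hz1 : z - s₀ ∈ closedBall (0 : Plane) d := by
          rw [mem_closedBall, dist_zero_right, ← dist_eq_norm]
          exact hs₀ hzS
        -- A cover ball of radius `ε / 2` whose centre is within `ε / 2` of `z` lies in `ball z ε`,
        -- hence in `S`; it is therefore one of the balls that `E₃` forces the sample to hit.
        obtain ⟨w, hw, hzw⟩ := mem_iUnion₂.1 (hF hz1)
        have hzw' : dist z (s₀ + w) < ε / 2 := by
          rw [mem_ball, dist_eq_norm] at hzw
          rw [dist_eq_norm, ← sub_sub]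
          exact hzw
        have hBw : B w ⊆ ball z ε := fun y hy => by
          rw [mem_ball] at hy ⊢
          linarith [dist_triangle y (s₀ + w) z, dist_comm z (s₀ + w)]
        have h4 := mem_iInter₂.1 h3 w ⟨hw, hBw.trans hz⟩
        simp only [mem_compl_iff, mem_iInter, mem_preimage, not_forall, not_not] at h4
        obtain ⟨i, hi⟩ := h4
        exact ⟨_, ⟨i, rfl⟩, hBw hi⟩
      · rintro c _ ⟨i, rfl⟩ _ ⟨j, rfl⟩ _ ⟨k, rfl⟩ hi hj hk hij
        by_contra hne
        push Not at hne
        have hq : (i, j, k) ∈ {q : Fin n × Fin n × Fin n | q.1 ≠ q.2.2 ∧ q.2.1 ≠ q.2.2} :=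
          ⟨fun h : i = k => hne.1 (by rw [h]), fun h : j = k => hne.2 (by rw [h])⟩
        have h5 := mem_iInter₂.1 h2 _ hq
        rcases eq_circleCenter hij hi hj with h | h
        · exact mem_iInter₂.1 h5 1 (Or.inl rfl) (by rw [h] at hk; exact hk)
        · exact mem_iInter₂.1 h5 (-1) (Or.inr rfl) (by rw [h] at hk; exact hk)
    exact H.alphaShape_structure
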